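/- Let $D$ be a domain (nonempty connected open set) in $\mathbb R^n$, and for $z\in D$ let $d_D(z)=\operatorname{dist}(z,\partial D)$. For $z,w\in D$ let $$h_D(z,w)=\inf_\gamma\int_\gamma\frac{|du|}{d_D(u)}$$ be the quasi-hyperbolic distance, where the infimum is taken over all rectifiable curves $\gamma$ in $D$ joining $z$ to $w$, and let $$s_D(z,w)=2\sinh^{-1}\frac{|z-w|}{2\sqrt{d_D(z)d_D(w)}}.$$ A point $a\in\partial D$ is called a $C^1$-smooth boundary point of $D$ if there are an open neighborhood $U$ of $a$ and a $C^1$ function $r:U\to\mathbb R$ with $\nabla r(a)\neq 0$ and $D\cap U=\{x\in U: r(x)>0\}$. The domain $D$ is called $C^1$-smooth if every point of $\partial D$ is a $C^1$-smooth boundary point of $D$. (a) If $a$ is a $C^1$-smooth boundary point of $D$, then $$\lim_{\substack{z,w\to a\\ z,w\in D,\ z\neq w}}\frac{h_D(z,w)}{s_D(z,w)}=1.$$ (b) If $D$ is bounded and $C^1$-smooth, then $$\lim_{z\to\partial D}\frac{h_D(z,w)}{s_D(z,w)}=1\quad\text{uniformly in } w\in D,\ w\neq z;$$ that is, for every $\varepsilon>0$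 there is $\delta>0$ such that $\left|\frac{h_D(z,w)}{s_D(z,w)}-1\right|<\varepsilon$ for all $z,w\in D$ with $w\ne z$ and $d_D(z)<\delta$. -/

import Mathlib

open Set Filter Topology MeasureTheory
open scoped ENNReal

noncomputable section

/-- `d_D(z)`, the Euclidean distance from `z` to the boundary of `D`. -/
def bdryDist {n : ℕ} (D : Set (EuclideanSpace ℝ (Fin n))) (z : EuclideanSpace ℝ (Fin n)) : ℝ :=
  Metric.infDist z (frontier D)

/-- The rectifiable curves `γ : [0, 1] → D` from `z` to `w`: continuous, of finite length
(values outside `[0, 1]` are irrelevant). -/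
structure IsRectifiableCurveIn {n : ℕ} (D : Set (EuclideanSpace ℝ (Fin n)))
    (z w : EuclideanSpace ℝ (Fin n)) (γ : ℝ → EuclideanSpace ℝ (Fin n)) : Prop where
  continuousOn : ContinuousOn γ (Icc 0 1)
  rectifiable : BoundedVariationOn γ (Icc 0 1)
  mapsTo : MapsTo γ (Icc 0 1) D
  source : γ 0 = z
  target : γ 1 = w

/-- The length of the curve `γ : [0, 1] → ℝⁿ`. -/
def curveLength {n : ℕ} (γ : ℝ → EuclideanSpace ℝ (Fin n)) : ℝ :=
  (eVariationOn γ (Icc 0 1)).toReal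

/-- The line integral `∫_γ f(u) |du|` of a nonnegative function with respect to arc length along
a rectifiable curve `γ : [0, 1] → ℝⁿ`, that is, the integral of `f` along the arc-length
parametrization of `γ`, which is defined on `[0, length γ]`. -/
def arcLengthIntegral {n : ℕ} (f : EuclideanSpace ℝ (Fin n) → ℝ≥0∞)
    (γ : ℝ → EuclideanSpace ℝ (Fin n)) : ℝ≥0∞ :=
  ∫⁻ t in Icc 0 (curveLength γ), f (naturalParameterization γ (Icc 0 1) 0 t)

/-- The quasi-hyperbolic distance `h_D(z, w) = inf_γ ∫_γ |du| / d_D(u)`, over all rectifiable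
curves `γ` in `D` joining `z` to `w`. -/
def quasihyperbolicDist {n : ℕ} (D : Set (EuclideanSpace ℝ (Fin n)))
    (z w : EuclideanSpace ℝ (Fin n)) : ℝ :=
  (⨅ (γ : ℝ → EuclideanSpace ℝ (Fin n)) (_ : IsRectifiableCurveIn D z w γ),
    arcLengthIntegral (fun u => (ENNReal.ofReal (bdryDist D u))⁻¹) γ).toReal

/-- `s_D(z, w) = 2 sinh⁻¹ (|z - w| / (2 √(d_D(z) d_D(w))))`. -/
def sinhDist {n : ℕ} (D : Set (EuclideanSpace ℝ (Fin n)))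
    (z w : EuclideanSpace ℝ (Fin n)) : ℝ :=
  2 * Real.arsinh (‖z - w‖ / (2 * Real.sqrt (bdryDist D z * bdryDist D w)))

/-- `a` is a `C¹`-smooth boundary point of `D`: near `a`, the set `D` is given by `r > 0`,
where `r` is a `C¹` function whose differential does not vanish at `a`
(hence, by continuity, near `a`). -/
def IsC1BoundaryPoint {n : ℕ} (D : Set (EuclideanSpace ℝ (Fin n)))
    (a : EuclideanSpace ℝ (Fin n)) : Prop :=
  a ∈ frontier D ∧
    ∃ (U : Set (EuclideanSpace ℝ (Fin n))) (r : EuclideanSpace ℝ (Fin n) → ℝ),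
      IsOpen U ∧ a ∈ U ∧ ContDiffOn ℝ 1 r U ∧ fderiv ℝ r a ≠ 0 ∧ D ∩ U = {x ∈ U | 0 < r x}

end

/-! In a half-space `⟪ν, ·⟫ > 0` the distance to the boundary is the height, and the
quasi-hyperbolic distance is the hyperbolic one, given exactly by the formula for `s_D`. The theorem
says that a `C¹` boundary is flat enough for this identity to survive asymptotically.

Local comparison (`exists_qhEDist_comparison`). For every `K > 1`, replacing the height of `x - a`
by the defining function `r` gives a `K`-bi-Lipschitz chart near `a` onto part of a half-space, with
heights within a factor `K` of `d_D` (`exists_isBoundaryChart`). Hence `s_D` is within `K ^ 2` of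
the hyperbolic distance of the images. For `h_D` from above, a hyperbolic geodesic is cut into short
pieces and its vertices, pulled back, are joined by straight segments (`qhEDist_le_halfSpaceDist`).
From below, a path that stays in the chart is at least as long, up to `K ^ 2`, as the hyperbolic
distance of its ends (`halfSpaceDist_le_setLIntegral`). A path that leaves the chart pays `log (1 /
d_D)` at both ends (`log_le_qhEDist_of_notMem_ball`), which exceeds `s_D` once `z` and `w` are close
enough to `a`. Letting `K → 1` gives (a).

Uniformity. Near `(a, b)` with `a ≠ b`, `a` on the boundary and `b` in the closure, both distances
equal `S = log (1 / d_D(z)) + log (1 / d_D(w))` up to additive constants and, for `h_D`, a factor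
`K` (`exists_comparison_of_ne`). As `S → ∞` when `z → a`, the ratio again tends to `1`. Compactness
of `frontier D ×ˢ closure D` then gives (b). -/

/-! ### Arc length and paths of speed at most one. -/

/-- The variation of a continuous function of locally bounded variation is continuous. -/
theorem continuousOn_variationOnFromTo {E : Type*} [PseudoMetricSpace E] {f : ℝ → E} {s : Set ℝ}
    (hf : LocallyBoundedVariationOn f s) (hc : ContinuousOn f s) {a : ℝ} (ha : a ∈ s) :
    ContinuousOn (variationOnFromTo f s a) s := by
  intro b hb
  have hL : Tendsto (variationOnFromTo f s a) (𝓝[s ∩ Iio b] b)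
      (𝓝 (variationOnFromTo f s a b)) := by
    have := variationOnFromTo.tendsto_left ha hb hf
      ((hc b hb).tendsto.mono_left (nhdsWithin_mono b inter_subset_left))
    simpa using this
  have hR : Tendsto (variationOnFromTo f s a) (𝓝[s ∩ Ioi b] b)
      (𝓝 (variationOnFromTo f s a b)) := by
    have := variationOnFromTo.tendsto_right ha hb hf
      ((hc b hb).tendsto.mono_left (nhdsWithin_mono b inter_subset_left))
    simpa using this
  have hs : s ⊆ (s ∩ Iio b ∪ s ∩ Ioi b) ∪ {b} := by
    intro x hx
    rcases lt_trichotomy x b with h | h | h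
    · exact Or.inl (Or.inl ⟨hx, h⟩)
    · exact Or.inr h
    · exact Or.inl (Or.inr ⟨hx, h⟩)
  refine ContinuousWithinAt.mono ?_ hs
  exact (ContinuousWithinAt.union hL hR).union continuousWithinAt_singleton

/-- The variation of a continuous curve on `[0, 1]` takes exactly the values in
`[0, curveLength γ]`. -/
theorem image_variationOnFromTo_Icc {n : ℕ} {γ : ℝ → EuclideanSpace ℝ (Fin n)}
    (hc : ContinuousOn γ (Icc 0 1)) (hv : BoundedVariationOn γ (Icc 0 1)) :
    variationOnFromTo γ (Icc 0 1) 0 '' Icc 0 1 = Icc 0 (curveLength γ) := by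
  have h0 : (0 : ℝ) ∈ Icc (0 : ℝ) 1 := by simp
  have h1 : (1 : ℝ) ∈ Icc (0 : ℝ) 1 := by simp
  have hl := hv.locallyBoundedVariationOn
  have hm := variationOnFromTo.monotoneOn hl h0
  have e0 : variationOnFromTo γ (Icc 0 1) 0 0 = 0 := variationOnFromTo.self _ _ _
  have e1 : variationOnFromTo γ (Icc 0 1) 0 1 = curveLength γ := by
    rw [variationOnFromTo.eq_of_le _ _ zero_le_one, inter_self, curveLength]
  apply Subset.antisymm
  · rintro _ ⟨t, ht, rfl⟩
    rw [← e1]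
    nth_rewrite 1 [← e0]
    exact ⟨hm h0 ht ht.1, hm ht h1 ht.2⟩
  · have := intermediate_value_Icc zero_le_one (continuousOn_variationOnFromTo hl hc h0)
    rwa [e0, e1] at this

theorem HasUnitSpeedOn.lipschitzOnWith {E : Type*} [PseudoEMetricSpace E] {f : ℝ → E} {s : Set ℝ}
    (hf : HasUnitSpeedOn f s) : LipschitzOnWith 1 f s := by
  have key : ∀ x ∈ s, ∀ y ∈ s, x ≤ y → edist (f x) (f y) ≤ edist x y := by
    intro x hx y hy hxy
    calc edist (f x) (f y) ≤ eVariationOn f (s ∩ Icc x y) :=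
          eVariationOn.edist_le f ⟨hx, le_rfl, hxy⟩ ⟨hy, hxy, le_rfl⟩
      _ = ENNReal.ofReal (y - x) := by simpa using hf hx hy
      _ = edist x y := by
          rw [edist_comm, edist_dist, Real.dist_eq, abs_of_nonneg (sub_nonneg.2 hxy)]
  intro x hx y hy
  rw [ENNReal.coe_one, one_mul]
  rcases le_total x y with h | h
  · exact key x hx y hy h
  · rw [edist_comm (f x), edist_comm x]
    exact key y hy x hx h

/-- A path in `D` from `z` to `w`, parametrized on `[0, L]` with speed at most one and extended
to all real times. -/
structure IsLipPath {n : ℕ} (D : Set (EuclideanSpace ℝ (Fin n)))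
    (z w : EuclideanSpace ℝ (Fin n)) (L : ℝ) (η : ℝ → EuclideanSpace ℝ (Fin n)) : Prop where
  nonneg : 0 ≤ L
  lipschitz : LipschitzWith 1 η
  mem : ∀ t, η t ∈ D
  source : η 0 = z
  target : η L = w

/-- The quasi-hyperbolic density `1 / d_D`. -/
noncomputable def qhDensity {n : ℕ} (D : Set (EuclideanSpace ℝ (Fin n)))
    (u : EuclideanSpace ℝ (Fin n)) : ℝ≥0∞ :=
  (ENNReal.ofReal (bdryDist D u))⁻¹

/-- The extended quasi-hyperbolic distance, as an infimum over paths of speed at most one. -/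
noncomputable def qhEDist {n : ℕ} (D : Set (EuclideanSpace ℝ (Fin n)))
    (z w : EuclideanSpace ℝ (Fin n)) : ℝ≥0∞ :=
  ⨅ (L : ℝ) (η : ℝ → EuclideanSpace ℝ (Fin n)) (_ : IsLipPath D z w L η),
    ∫⁻ t in Icc 0 L, qhDensity D (η t)

theorem qhEDist_le {n : ℕ} {D : Set (EuclideanSpace ℝ (Fin n))}
    {z w : EuclideanSpace ℝ (Fin n)} {L : ℝ} {η : ℝ → EuclideanSpace ℝ (Fin n)}
    (h : IsLipPath D z w L η) : qhEDist D z w ≤ ∫⁻ t in Icc 0 L, qhDensity D (η t) :=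
  iInf_le_of_le L (iInf_le_of_le η (iInf_le _ h))

theorem le_qhEDist {n : ℕ} {D : Set (EuclideanSpace ℝ (Fin n))}
    {z w : EuclideanSpace ℝ (Fin n)} {c : ℝ≥0∞}
    (h : ∀ L η, IsLipPath D z w L η → c ≤ ∫⁻ t in Icc 0 L, qhDensity D (η t)) :
    c ≤ qhEDist D z w :=
  le_iInf fun L => le_iInf fun η => le_iInf fun hη => h L η hη

/-- Restriction of a Lipschitz path on `[0, L]`. -/
theorem IsLipPath.of_lipschitzOnWith {n : ℕ} {D : Set (EuclideanSpace ℝ (Fin n))}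
    {L : ℝ} {η : ℝ → EuclideanSpace ℝ (Fin n)} (hL : 0 ≤ L)
    (hη : LipschitzOnWith 1 η (Icc 0 L)) (hD : MapsTo η (Icc 0 L) D) :
    IsLipPath D (η 0) (η L) L (fun t => η (projIcc 0 L hL t)) where
  nonneg := hL
  lipschitz := by
    have h1 : LipschitzWith 1 (fun t => ((projIcc 0 L hL t : Icc 0 L) : ℝ)) := by
      have := (LipschitzWith.subtype_val (Icc (0 : ℝ) L)).comp (LipschitzWith.projIcc hL)
      rwa [mul_one] at this
    rw [← lipschitzOnWith_univ] at h1 ⊢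
    have := hη.comp h1 (fun t _ => (projIcc 0 L hL t).2)
    rwa [mul_one] at this
  mem t := hD (projIcc 0 L hL t).2
  source := by simp
  target := by simp

theorem setLIntegral_projIcc {n : ℕ} {D : Set (EuclideanSpace ℝ (Fin n))}
    {L : ℝ} {η : ℝ → EuclideanSpace ℝ (Fin n)} (hL : 0 ≤ L) :
    ∫⁻ t in Icc 0 L, qhDensity D (η (projIcc 0 L hL t)) = ∫⁻ t in Icc 0 L, qhDensity D (η t) := by
  refine setLIntegral_congr_fun measurableSet_Icc fun t ht => ?_
  simp only [projIcc_of_mem hL ht]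

/-- The arc-length parametrization has unit speed. By continuity the variation takes every value in
`[0, curveLength γ]`, so the parametrization stays in `D` on the whole interval. -/
theorem qhEDist_le_arcLengthIntegral {n : ℕ} {D : Set (EuclideanSpace ℝ (Fin n))}
    {z w : EuclideanSpace ℝ (Fin n)} {γ : ℝ → EuclideanSpace ℝ (Fin n)}
    (h : IsRectifiableCurveIn D z w γ) :
    qhEDist D z w ≤ arcLengthIntegral (qhDensity D) γ := by
  have h0 : (0 : ℝ) ∈ Icc (0 : ℝ) 1 := by simp
  have h1 : (1 : ℝ) ∈ Icc (0 : ℝ) 1 := by simp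
  have hl := h.rectifiable.locallyBoundedVariationOn
  have him := image_variationOnFromTo_Icc h.continuousOn h.rectifiable
  have hval : ∀ t ∈ Icc (0 : ℝ) 1,
      naturalParameterization γ (Icc 0 1) 0 (variationOnFromTo γ (Icc 0 1) 0 t) = γ t :=
    fun t ht => edist_eq_zero.1 (edist_naturalParameterization_eq_zero hl h0 ht)
  have e1 : variationOnFromTo γ (Icc 0 1) 0 1 = curveLength γ := by
    rw [variationOnFromTo.eq_of_le _ _ zero_le_one, inter_self, curveLength]
  have hL : 0 ≤ curveLength γ := ENNReal.toReal_nonneg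
  have hlip : LipschitzOnWith 1 (naturalParameterization γ (Icc 0 1) 0)
      (Icc 0 (curveLength γ)) := by
    rw [← him]
    exact (has_unit_speed_naturalParameterization γ hl h0).lipschitzOnWith
  have hmem : MapsTo (naturalParameterization γ (Icc 0 1) 0) (Icc 0 (curveLength γ)) D := by
    rw [← him]
    rintro _ ⟨t, ht, rfl⟩
    rw [hval t ht]
    exact h.mapsTo ht
  have hp := IsLipPath.of_lipschitzOnWith hL hlip hmem
  have hz : naturalParameterization γ (Icc 0 1) 0 0 = z := by
    have := hval 0 h0
    rwa [variationOnFromTo.self, h.source] at this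
  have hw : naturalParameterization γ (Icc 0 1) 0 (curveLength γ) = w := by
    have := hval 1 h1
    rwa [e1, h.target] at this
  rw [hz, hw] at hp
  refine (qhEDist_le hp).trans_eq ?_
  rw [setLIntegral_projIcc hL]
  rfl

/-- A `1`-Lipschitz map does not increase Lebesgue measure, in terms of pushforwards. -/
theorem restrict_image_le_map_of_lipschitzWith {V : ℝ → ℝ} (hV : LipschitzWith 1 V) (s : Set ℝ) :
    (volume : Measure ℝ).restrict (V '' s) ≤ (volume.restrict s).map V := by
  have hm : Measurable V := hV.continuous.measurable
  refine Measure.le_intro fun A hA _ => ?_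
  rw [Measure.map_apply hm hA, Measure.restrict_apply hA, Measure.restrict_apply (hm hA)]
  have hsub : A ∩ V '' s ⊆ V '' (V ⁻¹' A ∩ s) := by
    rintro _ ⟨hA, x, hx, rfl⟩
    exact ⟨x, ⟨hA, hx⟩, rfl⟩
  refine (measure_mono hsub).trans ?_
  -- On `ℝ`, Lebesgue measure is the one-dimensional Hausdorff measure.
  have := hV.hausdorffMeasure_image_le (zero_le_one : (0 : ℝ) ≤ 1) (V ⁻¹' A ∩ s)
  simpa [hausdorffMeasure_real] using this

theorem lipschitzOnWith_variationOnFromTo {E : Type*} [PseudoEMetricSpace E] {η : ℝ → E}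
    {s : Set ℝ} (hη : LipschitzWith 1 η) {a : ℝ} (ha : a ∈ s) :
    LipschitzOnWith 1 (variationOnFromTo η s a) s := by
  have hl : LocallyBoundedVariationOn η s := fun x y hx hy =>
    hη.locallyBoundedVariationOn s x y hx hy
  have key : ∀ x ∈ s, ∀ y ∈ s, x ≤ y →
      dist (variationOnFromTo η s a x) (variationOnFromTo η s a y) ≤ dist x y := by
    intro x hx y hy hxy
    rw [dist_comm, dist_comm x, Real.dist_eq, Real.dist_eq,
      variationOnFromTo.sub_right hl ha hy hx, variationOnFromTo.eq_of_le _ _ hxy,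
      abs_of_nonneg ENNReal.toReal_nonneg, abs_of_nonneg (sub_nonneg.2 hxy)]
    refine ENNReal.toReal_le_of_le_ofReal (sub_nonneg.2 hxy) ?_
    have := (hη.lipschitzOnWith (s := univ)).comp_eVariationOn_le (f := η) (g := id)
      (s := s ∩ Icc x y) (mapsTo_univ _ _)
    rwa [ENNReal.coe_one, one_mul, eVariationOn_id hx hy] at this
  refine LipschitzOnWith.of_dist_le_mul fun x hx y hy => ?_
  rw [NNReal.coe_one, one_mul]
  rcases le_total x y with h | h
  · exact key x hx y hy h
  · rw [dist_comm, dist_comm x]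
    exact key y hy x hx h

/-- The arc-length function `V` of `η` is `1`-Lipschitz, so substituting `s = V t` can only lower
the integral; no differentiability is needed. The curve is `η` rescaled to `[0, 1]`, and `L = 0` is
allowed because the rescaling need only be monotone. -/
theorem arcLengthIntegral_le_of_isLipPath {n : ℕ} {D : Set (EuclideanSpace ℝ (Fin n))}
    {z w : EuclideanSpace ℝ (Fin n)} {L : ℝ} {η : ℝ → EuclideanSpace ℝ (Fin n)}
    (h : IsLipPath D z w L η) :
    ∃ γ, IsRectifiableCurveIn D z w γ ∧
      arcLengthIntegral (qhDensity D) γ ≤ ∫⁻ t in Icc 0 L, qhDensity D (η t) := by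
  have hL := h.nonneg
  have h0L : (0 : ℝ) ∈ Icc 0 L := ⟨le_rfl, hL⟩
  have h0 : (0 : ℝ) ∈ Icc (0 : ℝ) 1 := by simp
  set φ : ℝ → ℝ := fun t => L * t with hφ
  have hφm : MonotoneOn φ (Icc 0 1) := fun x _ y _ hxy => mul_le_mul_of_nonneg_left hxy hL
  have himφ : φ '' Icc 0 1 = Icc 0 L := by
    rw [hφ, image_mul_left_Icc hL zero_le_one, mul_zero, mul_one]
  set γ := η ∘ φ with hγ
  have hcont : Continuous γ := h.lipschitz.continuous.comp (continuous_const.mul continuous_id)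
  have hbv : BoundedVariationOn γ (Icc 0 1) := by
    have := h.lipschitz.locallyBoundedVariationOn (Icc 0 L) 0 L h0L ⟨hL, le_rfl⟩
    rw [inter_self, ← himφ] at this
    unfold BoundedVariationOn at this ⊢
    rwa [hγ, eVariationOn.comp_eq_of_monotoneOn η φ hφm]
  have hcurve : IsRectifiableCurveIn D z w γ :=
    ⟨hcont.continuousOn, hbv, fun t _ => h.mem _, by simp [hγ, hφ, h.source],
      by simp [hγ, hφ, h.target]⟩
  refine ⟨γ, hcurve, ?_⟩
  set V₀ := variationOnFromTo η (Icc 0 L) 0 with hV₀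
  set V : ℝ → ℝ := fun t => V₀ (projIcc 0 L hL t) with hV
  have hVlip : LipschitzWith 1 V := by
    have h1 : LipschitzWith 1 (fun t => ((projIcc 0 L hL t : Icc 0 L) : ℝ)) := by
      have := (LipschitzWith.subtype_val (Icc (0 : ℝ) L)).comp (LipschitzWith.projIcc hL)
      rwa [mul_one] at this
    rw [← lipschitzOnWith_univ] at h1 ⊢
    have := (lipschitzOnWith_variationOnFromTo h.lipschitz h0L).comp h1
      (fun t _ => (projIcc 0 L hL t).2)
    rwa [mul_one] at this
  have hvar : ∀ t ∈ Icc (0 : ℝ) 1, variationOnFromTo γ (Icc 0 1) 0 t = V (φ t) := by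
    intro t ht
    have hmem : φ t ∈ Icc 0 L := himφ ▸ mem_image_of_mem φ ht
    have := variationOnFromTo.comp_eq_of_monotoneOn η φ hφm h0 ht
    rw [himφ] at this
    rw [hγ, this, hV]
    simp only [projIcc_of_mem hL hmem, hV₀]
    simp only [hφ, mul_zero]
  have himV : V '' Icc 0 L = Icc 0 (curveLength γ) := by
    rw [← image_variationOnFromTo_Icc hcont.continuousOn hbv, ← himφ, image_image]
    exact (image_congr hvar).symm
  have hnat : ∀ s ∈ Icc 0 L, naturalParameterization γ (Icc 0 1) 0 (V s) = η s := by
    intro s hs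
    rw [← himφ] at hs
    obtain ⟨t, ht, rfl⟩ := hs
    rw [← hvar t ht]
    exact edist_eq_zero.1
      (edist_naturalParameterization_eq_zero hbv.locallyBoundedVariationOn h0 ht)
  calc arcLengthIntegral (qhDensity D) γ
      = ∫⁻ t in V '' Icc 0 L, qhDensity D (naturalParameterization γ (Icc 0 1) 0 t) := by
        rw [himV]; rfl
    _ ≤ ∫⁻ t, qhDensity D (naturalParameterization γ (Icc 0 1) 0 t)
          ∂((volume.restrict (Icc 0 L)).map V) :=
        lintegral_mono' (restrict_image_le_map_of_lipschitzWith hVlip _) le_rfl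
    -- This direction of the change of variables requires no measurability of the integrand.
    _ ≤ ∫⁻ t in Icc 0 L, qhDensity D (naturalParameterization γ (Icc 0 1) 0 (V t)) :=
        lintegral_map_le _ _
    _ = ∫⁻ t in Icc 0 L, qhDensity D (η t) :=
        setLIntegral_congr_fun measurableSet_Icc fun s hs => by simp only [hnat s hs]

theorem quasihyperbolicDist_eq {n : ℕ} (D : Set (EuclideanSpace ℝ (Fin n)))
    (z w : EuclideanSpace ℝ (Fin n)) :
    quasihyperbolicDist D z w = (qhEDist D z w).toReal := by
  refine congrArg ENNReal.toReal (le_antisymm ?_ ?_)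
  · refine le_qhEDist fun L η h => ?_
    obtain ⟨γ, hγ, hle⟩ := arcLengthIntegral_le_of_isLipPath h
    exact (iInf₂_le γ hγ).trans hle
  · exact le_iInf₂ fun γ hγ => qhEDist_le_arcLengthIntegral hγ

/-! ### Metric properties of the quasi-hyperbolic distance. -/

section Basic

variable {n : ℕ} {D : Set (EuclideanSpace ℝ (Fin n))} {z w : EuclideanSpace ℝ (Fin n)}

/-- A nonempty frontier matters: `Metric.infDist` to the empty set is `0`. -/
theorem bdryDist_pos (hDo : IsOpen D) (hne : (frontier D).Nonempty) (hz : z ∈ D) :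
    0 < bdryDist D z := by
  refine (isClosed_frontier.notMem_iff_infDist_pos hne).1 fun h => ?_
  rw [hDo.frontier_eq] at h
  exact h.2 hz

theorem bdryDist_le_add : bdryDist D z ≤ bdryDist D w + ‖z - w‖ := by
  rw [← dist_eq_norm]
  exact Metric.infDist_le_infDist_add_dist

theorem continuous_bdryDist : Continuous (bdryDist D) :=
  Metric.continuous_infDist_pt _

/-- A point of the frontier realizes the distance from `z` to the complement. -/
theorem bdryDist_le_of_notMem (hz : z ∈ D) (hw : w ∉ D) : bdryDist D z ≤ ‖z - w‖ := by
  obtain ⟨y, hy, hyd⟩ := exists_mem_frontier_infDist_compl_eq_dist hz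
    (fun h => hw (h ▸ mem_univ w))
  rw [← dist_eq_norm]
  calc bdryDist D z ≤ dist z y := Metric.infDist_le_dist_of_mem hy
    _ = Metric.infDist z Dᶜ := hyd.symm
    _ ≤ dist z w := Metric.infDist_le_dist_of_mem hw

/-- The ball of radius `d_D(z)` around `z` is contained in `D`. -/
theorem mem_of_norm_sub_lt_bdryDist (hz : z ∈ D) (hw : ‖z - w‖ < bdryDist D z) : w ∈ D :=
  not_not.1 fun h => absurd (bdryDist_le_of_notMem hz h) (not_le.2 hw)

theorem LipschitzWith.norm_sub_le_abs {E : Type*} [SeminormedAddCommGroup E] {η : ℝ → E}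
    (h : LipschitzWith 1 η) (s t : ℝ) : ‖η s - η t‖ ≤ |s - t| := by
  simpa [dist_eq_norm, Real.dist_eq] using h.dist_le_mul s t

/-- Concatenation of two paths. -/
theorem IsLipPath.trans {u : EuclideanSpace ℝ (Fin n)} {L₁ L₂ : ℝ}
    {η₁ η₂ : ℝ → EuclideanSpace ℝ (Fin n)} (h₁ : IsLipPath D z u L₁ η₁)
    (h₂ : IsLipPath D u w L₂ η₂) :
    IsLipPath D z w (L₁ + L₂) (fun t => if t ≤ L₁ then η₁ t else η₂ (t - L₁)) where
  nonneg := add_nonneg h₁.nonneg h₂.nonneg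
  lipschitz := by
    -- As a sum of two paths, each frozen while the other moves, the concatenation has increments
    -- adding up to exactly `|s - t|`.
    have key : (fun t => if t ≤ L₁ then η₁ t else η₂ (t - L₁)) =
        fun t => η₁ (min t L₁) + η₂ (max (t - L₁) 0) - u := by
      funext t
      split_ifs with h
      · rw [min_eq_left h, max_eq_right (by linarith), h₂.source, add_sub_cancel_right]
      · rw [min_eq_right (by linarith), max_eq_left (by linarith), h₁.target,
          add_sub_cancel_left]
    rw [key]
    refine LipschitzWith.of_dist_le_mul fun s t => ?_
    rw [NNReal.coe_one, one_mul, dist_eq_norm, Real.dist_eq]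
    calc ‖η₁ (min s L₁) + η₂ (max (s - L₁) 0) - u - (η₁ (min t L₁) + η₂ (max (t - L₁) 0) - u)‖
        = ‖(η₁ (min s L₁) - η₁ (min t L₁)) + (η₂ (max (s - L₁) 0) - η₂ (max (t - L₁) 0))‖ := by
          congr 1; abel
      _ ≤ |min s L₁ - min t L₁| + |max (s - L₁) 0 - max (t - L₁) 0| :=
          (norm_add_le _ _).trans (add_le_add (h₁.lipschitz.norm_sub_le_abs _ _)
            (h₂.lipschitz.norm_sub_le_abs _ _))
      _ = |s - t| := by
          rcases le_total s t with h | h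
          · rw [abs_of_nonpos (sub_nonpos.2 h),
              abs_of_nonpos (sub_nonpos.2 (min_le_min_right _ h)),
              abs_of_nonpos (sub_nonpos.2 (max_le_max_right _ (by linarith)))]
            rcases le_total s L₁ with h1 | h1 <;> rcases le_total t L₁ with h2 | h2 <;>
              simp [h1, h2]
          · rw [abs_of_nonneg (sub_nonneg.2 h),
              abs_of_nonneg (sub_nonneg.2 (min_le_min_right _ h)),
              abs_of_nonneg (sub_nonneg.2 (max_le_max_right _ (by linarith)))]
            rcases le_total s L₁ with h1 | h1 <;> rcases le_total t L₁ with h2 | h2 <;>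
              simp [h1, h2]
  mem t := by
    split_ifs
    · exact h₁.mem _
    · exact h₂.mem _
  source := by rw [if_pos h₁.nonneg, h₁.source]
  target := by
    split_ifs with h
    · have : L₂ = 0 := le_antisymm (by linarith) h₂.nonneg
      rw [← h₂.target, this, h₂.source, add_zero, h₁.target]
    · rw [add_sub_cancel_left, h₂.target]

theorem setLIntegral_Icc_add {a b c : ℝ} (hab : a ≤ b) (hbc : b ≤ c) (f : ℝ → ℝ≥0∞) :
    ∫⁻ t in Icc a c, f t = (∫⁻ t in Icc a b, f t) + ∫⁻ t in Icc b c, f t := by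
  rw [← Icc_union_Ioc_eq_Icc hab hbc, lintegral_union measurableSet_Ioc, setLIntegral_congr
    (Ioc_ae_eq_Icc (a := b) (b := c) (μ := volume))]
  exact disjoint_left.2 fun x hx hx' => absurd hx.2 (not_le.2 hx'.1)

theorem setLIntegral_Icc_add_left (a b c : ℝ) (f : ℝ → ℝ≥0∞) :
    ∫⁻ t in Icc a b, f (t + c) = ∫⁻ t in Icc (a + c) (b + c), f t := by
  have hp := measurePreserving_add_right (volume : Measure ℝ) c
  have := hp.setLIntegral_comp_preimage_emb (measurableEmbedding_addRight c) f
    (Icc (a + c) (b + c))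
  rw [← this]
  congr 3
  ext x
  simp

theorem setLIntegral_Icc_neg (L : ℝ) (f : ℝ → ℝ≥0∞) :
    ∫⁻ t in Icc 0 L, f (L - t) = ∫⁻ t in Icc 0 L, f t := by
  have hp : MeasurePreserving (fun t => L - t) (volume : Measure ℝ) volume :=
    Measure.measurePreserving_sub_left (volume : Measure ℝ) L
  have := hp.setLIntegral_comp_preimage_emb
    (MeasurableEquiv.subLeft L).measurableEmbedding f (Icc 0 L)
  rw [← this]
  congr 3
  ext x
  simp [and_comm]

theorem qhEDist_triangle (u : EuclideanSpace ℝ (Fin n)) :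
    qhEDist D z w ≤ qhEDist D z u + qhEDist D u w := by
  rw [qhEDist.eq_def D z u, qhEDist.eq_def D u w]
  simp only [ENNReal.iInf_add, ENNReal.add_iInf]
  refine le_iInf fun L₂ => le_iInf fun η₂ => le_iInf fun h₂ => le_iInf fun L₁ =>
    le_iInf fun η₁ => le_iInf fun h₁ => (qhEDist_le (h₁.trans h₂)).trans_eq ?_
  rw [setLIntegral_Icc_add h₁.nonneg (le_add_of_nonneg_right h₂.nonneg)]
  congr 1
  · exact setLIntegral_congr_fun measurableSet_Icc fun t ht => by simp only [if_pos ht.2]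
  · have := setLIntegral_Icc_add_left 0 L₂ L₁
      (fun t => qhDensity D (if t ≤ L₁ then η₁ t else η₂ (t - L₁)))
    rw [zero_add, add_comm L₂] at this
    rw [← this]
    refine setLIntegral_congr_fun measurableSet_Icc fun t ht => ?_
    simp only [add_sub_cancel_right]
    split_ifs with h
    · have : t = 0 := le_antisymm (by linarith) ht.1
      rw [this, zero_add, h₁.target, h₂.source]
    · rfl

theorem IsLipPath.symm {L : ℝ} {η : ℝ → EuclideanSpace ℝ (Fin n)} (h : IsLipPath D z w L η) :
    IsLipPath D w z L (fun t => η (L - t)) where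
  nonneg := h.nonneg
  lipschitz := by
    refine LipschitzWith.of_dist_le_mul fun s t => ?_
    rw [NNReal.coe_one, one_mul, dist_eq_norm, Real.dist_eq]
    refine (h.lipschitz.norm_sub_le_abs _ _).trans_eq ?_
    rw [sub_sub_sub_cancel_left, abs_sub_comm]
  mem t := h.mem _
  source := by rw [sub_zero, h.target]
  target := by rw [sub_self, h.source]

theorem qhEDist_comm : qhEDist D z w = qhEDist D w z := by
  have key : ∀ z w, qhEDist D z w ≤ qhEDist D w z := fun z w => le_qhEDist fun L η h =>
    (qhEDist_le h.symm).trans_eq (setLIntegral_Icc_neg L fun t => qhDensity D (η t))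
  exact le_antisymm (key z w) (key w z)

/-- Cutting a path at an intermediate time. -/
theorem IsLipPath.qhEDist_add_le {L τ : ℝ} {η : ℝ → EuclideanSpace ℝ (Fin n)}
    (h : IsLipPath D z w L η) (hτ : τ ∈ Icc 0 L) :
    qhEDist D z (η τ) + qhEDist D (η τ) w ≤ ∫⁻ t in Icc 0 L, qhDensity D (η t) := by
  rw [setLIntegral_Icc_add hτ.1 hτ.2]
  refine add_le_add (qhEDist_le ⟨hτ.1, h.lipschitz, h.mem, h.source, rfl⟩) ?_
  have h2 : IsLipPath D (η τ) w (L - τ) (fun t => η (t + τ)) :=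
    ⟨sub_nonneg.2 hτ.2, LipschitzWith.of_dist_le_mul fun s t => by
      simpa using h.lipschitz.dist_le_mul (s + τ) (t + τ), fun t => h.mem _, by rw [zero_add],
      by rw [sub_add_cancel, h.target]⟩
  refine (qhEDist_le h2).trans_eq ?_
  rw [setLIntegral_Icc_add_left 0 (L - τ) τ (fun t => qhDensity D (η t)), zero_add,
    sub_add_cancel]

/-- The estimate along a straight segment. -/
theorem qhEDist_le_of_norm_sub_lt (hz : z ∈ D) (h : ‖z - w‖ < bdryDist D z) :
    qhEDist D z w ≤ ENNReal.ofReal (‖z - w‖ / (bdryDist D z - ‖z - w‖)) := by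
  set ℓ := ‖z - w‖ with hℓ
  -- For `z = w` the convention `0⁻¹ = 0` gives `e = 0`, so only `‖e‖ ≤ 1` is available.
  set e := ℓ⁻¹ • (w - z) with he
  have hℓ0 : 0 ≤ ℓ := norm_nonneg _
  have hwz : ‖w - z‖ = ℓ := by rw [hℓ, norm_sub_rev]
  have he1 : ‖e‖ ≤ 1 := by
    rw [he, norm_smul, norm_inv, hwz, Real.norm_of_nonneg hℓ0]
    exact inv_mul_le_one
  set η : ℝ → EuclideanSpace ℝ (Fin n) := fun t => z + t • e with hη
  have hdist : ∀ t ∈ Icc 0 ℓ, ‖z - η t‖ ≤ ℓ := by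
    intro t ht
    rw [hη, sub_add_cancel_left, norm_neg, norm_smul, Real.norm_of_nonneg ht.1]
    exact (mul_le_of_le_one_right ht.1 he1).trans ht.2
  have hlip : LipschitzOnWith 1 η (Icc 0 ℓ) := by
    refine LipschitzOnWith.of_dist_le_mul fun s _ t _ => ?_
    rw [NNReal.coe_one, one_mul, dist_eq_norm, Real.dist_eq, hη, add_sub_add_left_eq_sub,
      ← sub_smul, norm_smul, Real.norm_eq_abs]
    exact mul_le_of_le_one_right (abs_nonneg _) he1
  have hmem : MapsTo η (Icc 0 ℓ) D := fun t ht =>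
    mem_of_norm_sub_lt_bdryDist hz ((hdist t ht).trans_lt h)
  have hp := IsLipPath.of_lipschitzOnWith hℓ0 hlip hmem
  have e0 : η 0 = z := by simp [hη]
  have e1 : η ℓ = w := by
    simp only [hη, he]
    rcases eq_or_ne ℓ 0 with h0 | h0
    · rw [h0, zero_smul, add_zero]
      rw [h0] at hℓ
      exact sub_eq_zero.1 (norm_eq_zero.1 hℓ.symm)
    · rw [smul_inv_smul₀ h0, add_sub_cancel]
  rw [e0, e1] at hp
  refine (qhEDist_le hp).trans ?_
  rw [setLIntegral_projIcc hℓ0]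
  calc ∫⁻ t in Icc 0 ℓ, qhDensity D (η t)
      ≤ ∫⁻ _ in Icc 0 ℓ, ENNReal.ofReal (bdryDist D z - ℓ)⁻¹ := by
        refine setLIntegral_mono' measurableSet_Icc fun t ht => ?_
        rw [qhDensity, ENNReal.ofReal_inv_of_pos (sub_pos.2 h)]
        refine ENNReal.inv_le_inv.2 (ENNReal.ofReal_le_ofReal ?_)
        have := bdryDist_le_add (D := D) (z := z) (w := η t)
        linarith [hdist t ht]
    _ = ENNReal.ofReal (ℓ / (bdryDist D z - ℓ)) := by
        rw [setLIntegral_const, Real.volume_Icc, sub_zero,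
          ← ENNReal.ofReal_mul (inv_nonneg.2 (sub_pos.2 h).le), div_eq_inv_mul]

/-- The quasi-hyperbolic distance is finite on domains with nonempty boundary. -/
theorem qhEDist_ne_top (hDo : IsOpen D) (hDc : IsConnected D) (hne : (frontier D).Nonempty)
    (hz : z ∈ D) (hw : w ∈ D) : qhEDist D z w ≠ ⊤ := by
  -- Being at finite distance is a symmetric, transitive relation that holds locally, hence on all
  -- of a connected set.
  refine hDc.isPreconnected.induction₂ (fun x y => qhEDist D x y ≠ ⊤) ?_ ?_ ?_ hz hw
  · intro x hx
    refine mem_nhdsWithin_of_mem_nhds ?_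
    filter_upwards [Metric.ball_mem_nhds x (bdryDist_pos hDo hne hx)] with y hy
    rw [Metric.mem_ball, dist_comm, dist_eq_norm] at hy
    exact ne_top_of_le_ne_top ENNReal.ofReal_ne_top (qhEDist_le_of_norm_sub_lt hx hy)
  · intro x y u _ _ _ h1 h2
    exact ne_top_of_le_ne_top (ENNReal.add_ne_top.2 ⟨h1, h2⟩) (qhEDist_triangle y)
  · intro x y _ _ h
    rwa [qhEDist_comm]

/-- A function along a path whose increments are controlled by `C / d_D` varies by at most `C`
times the quasi-hyperbolic length. -/
theorem IsLipPath.ofReal_sub_le {L : ℝ} {η : ℝ → EuclideanSpace ℝ (Fin n)}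
    (h : IsLipPath D z w L η) (hd : ∀ u ∈ D, 0 < bdryDist D u) {G : ℝ → ℝ} {C : ℝ} (hC : 0 ≤ C)
    (hG : ∀ s ∈ Icc 0 L, ∀ t ∈ Icc 0 L,
      |G s - G t| ≤ C * (|s - t| / √(bdryDist D (η s) * bdryDist D (η t)))) :
    ENNReal.ofReal (G L - G 0) ≤ ENNReal.ofReal C * ∫⁻ t in Icc 0 L, qhDensity D (η t) := by
  have hdη : ∀ t, 0 < bdryDist D (η t) := fun t => hd _ (h.mem t)
  have hcη : Continuous fun t => bdryDist D (η t) := continuous_bdryDist.comp h.lipschitz.continuous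
  have hci : Continuous fun t => (bdryDist D (η t))⁻¹ := hcη.inv₀ fun t => (hdη t).ne'
  have hint : ∫⁻ t in Icc 0 L, qhDensity D (η t) =
      ENNReal.ofReal (∫ t in (0 : ℝ)..L, (bdryDist D (η t))⁻¹) := by
    rw [intervalIntegral.integral_of_le h.nonneg, ← integral_Icc_eq_integral_Ioc,
      ofReal_integral_eq_lintegral_ofReal]
    · refine lintegral_congr fun t => ?_
      rw [qhDensity, ENNReal.ofReal_inv_of_pos (hdη t)]
    · exact hci.continuousOn.integrableOn_Icc
    · exact Eventually.of_forall fun t => (inv_nonneg.2 (hdη t).le)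
  rw [hint, ← ENNReal.ofReal_mul hC]
  refine ENNReal.ofReal_le_ofReal ?_
  have hlim : ∀ x, Tendsto (fun t => C * (1 / √(bdryDist D (η x) * bdryDist D (η t)))) (𝓝 x)
      (𝓝 (C * (bdryDist D (η x))⁻¹)) := by
    intro x
    have : ContinuousAt (fun t => C * (1 / √(bdryDist D (η x) * bdryDist D (η t)))) x := by
      refine ContinuousAt.mul continuousAt_const (ContinuousAt.div continuousAt_const ?_ ?_)
      · exact (Real.continuous_sqrt.comp (continuous_const.mul hcη)).continuousAt
      · exact (Real.sqrt_pos.2 (mul_pos (hdη x) (hdη x))).ne'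
    have := this.tendsto
    rwa [Real.sqrt_mul_self (hdη x).le, one_div] at this
  have hGc : ContinuousOn G (Icc 0 L) := by
    intro x hx
    rw [ContinuousWithinAt, tendsto_iff_dist_tendsto_zero]
    have h0 : Tendsto (fun t => |x - t| * (C * (1 / √(bdryDist D (η x) * bdryDist D (η t)))))
        (𝓝[Icc 0 L] x) (𝓝 0) := by
      have h1 : Tendsto (fun t : ℝ => |x - t|) (𝓝 x) (𝓝 0) := by
        have : Continuous fun t : ℝ => |x - t| := by fun_prop
        simpa using this.tendsto x
      have := h1.mul (hlim x)
      rw [zero_mul] at this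
      exact this.mono_left nhdsWithin_le_nhds
    refine squeeze_zero' (Eventually.of_forall fun _ => dist_nonneg) ?_ h0
    filter_upwards [self_mem_nhdsWithin] with t ht
    rw [dist_comm, Real.dist_eq]
    refine (hG x hx t ht).trans_eq (by ring)
  -- `G` need not be differentiable: its right slopes at `x` are bounded by quantities tending to `C
  -- / d_D (η x)`, the derivative of the comparison function.
  have hmain := image_le_of_liminf_slope_right_le_deriv_boundary
    (f := G) (a := 0) (b := L) hGc
    (B := fun x => G 0 + C * ∫ t in (0 : ℝ)..x, (bdryDist D (η t))⁻¹)
    (B' := fun x => C * (bdryDist D (η x))⁻¹) (by simp) ?_ ?_ ?_ (right_mem_Icc.2 h.nonneg)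
  · linarith
  · intro x _
    exact (((hci.integral_hasStrictDerivAt 0 x).hasDerivAt.const_mul C).const_add
      (G 0)).continuousAt.continuousWithinAt
  · intro x _
    exact (((hci.integral_hasStrictDerivAt 0 x).hasDerivAt.const_mul C).const_add
      (G 0)).hasDerivWithinAt
  · intro x hx r hr
    refine Eventually.frequently ?_
    have h1 := (hlim x).mono_left (nhdsWithin_le_nhds (s := Ioi x))
    filter_upwards [h1.eventually_lt_const hr, Ioo_mem_nhdsGT hx.2] with t ht htm
    refine lt_of_le_of_lt ?_ ht
    rw [slope_def_field, div_le_iff₀ (sub_pos.2 htm.1)]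
    refine (le_abs_self _).trans ?_
    rw [abs_sub_comm]
    refine (hG x ⟨hx.1, hx.2.le⟩ t ⟨hx.1.trans htm.1.le, htm.2.le⟩).trans_eq ?_
    rw [abs_sub_comm, abs_of_pos (sub_pos.2 htm.1)]
    ring

end Basic

/-! ### Hyperbolic distance of a half-space, by projection to the upper half-plane. -/

section HalfSpace

variable {E : Type*} [NormedAddCommGroup E] [InnerProductSpace ℝ E]

/-- The hyperbolic distance of the half-space `⟪ν, ·⟫ > 0`, where `ν` is a unit vector. -/
noncomputable def halfSpaceDist (ν u v : E) : ℝ :=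
  2 * Real.arsinh (‖u - v‖ / (2 * √(inner ℝ ν u * inner ℝ ν v)))

theorem halfSpaceDist_nonneg (ν u v : E) : 0 ≤ halfSpaceDist ν u v :=
  mul_nonneg zero_le_two (Real.arsinh_nonneg_iff.2 (by positivity))

/-- A two-dimensional Bessel inequality. -/
theorem inner_sq_add_inner_sq_le {ν e : E} (hν : ‖ν‖ = 1) (he : ‖e‖ ≤ 1)
    (heν : inner ℝ e ν = 0) (v : E) : inner ℝ e v ^ 2 + inner ℝ ν v ^ 2 ≤ ‖v‖ ^ 2 := by
  set v' := v - (inner ℝ ν v : ℝ) • ν with hv'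
  have h1 : ‖v'‖ ^ 2 = ‖v‖ ^ 2 - inner ℝ ν v ^ 2 := by
    rw [hv', norm_sub_sq_real, inner_smul_right, norm_smul, hν, mul_one, Real.norm_eq_abs, sq_abs,
      real_inner_comm]
    ring
  have h2 : inner ℝ e v' = inner ℝ e v := by
    rw [hv', inner_sub_right, inner_smul_right, heν, mul_zero, sub_zero]
  have h3 : inner ℝ e v ^ 2 ≤ ‖v'‖ ^ 2 := by
    rw [← h2]
    refine sq_le_sq' ?_ ?_
    · have := neg_le_of_abs_le (abs_real_inner_le_norm e v')
      nlinarith [norm_nonneg v']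
    · have := real_inner_le_norm e v'
      nlinarith [norm_nonneg v']
  linarith

/-- Any vector lies in the span of `ν` and a vector of norm at most one orthogonal to `ν`. -/
theorem exists_horizontal (ν : E) (hν : ‖ν‖ = 1) (v : E) :
    ∃ (e : E) (d : ℝ), 0 ≤ d ∧ inner ℝ e ν = 0 ∧ v = d • e + (inner ℝ ν v : ℝ) • ν ∧
      (d = 0 ∧ e = 0 ∨ 0 < d ∧ ‖e‖ = 1) := by
  set h := v - (inner ℝ ν v : ℝ) • ν with hh
  have hperp : inner ℝ h ν = 0 := by
    rw [hh, inner_sub_left, inner_smul_left, real_inner_self_eq_norm_sq, hν, real_inner_comm]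
    simp
  -- When `v` is vertical, `e = 0` is used; in dimension one there is no unit vector orthogonal to
  -- `ν`.
  rcases eq_or_ne h 0 with h0 | h0
  · exact ⟨0, 0, le_rfl, inner_zero_left _, by rw [zero_smul, zero_add]; exact sub_eq_zero.1 h0,
      Or.inl ⟨rfl, rfl⟩⟩
  · have hn : 0 < ‖h‖ := norm_pos_iff.2 h0
    refine ⟨‖h‖⁻¹ • h, ‖h‖, hn.le, by rw [inner_smul_left, hperp, mul_zero], ?_,
      Or.inr ⟨hn, ?_⟩⟩
    · rw [smul_inv_smul₀ hn.ne', hh, sub_add_cancel]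
    · rw [norm_smul, norm_inv, norm_norm, inv_mul_cancel₀ hn.ne']

/-- The map to the upper half-plane given by projection to the plane spanned by `e` and `ν`. -/
noncomputable def toUpperHalfPlane (ν e u : E) (hu : 0 < inner ℝ ν u) : UpperHalfPlane :=
  UpperHalfPlane.mk ⟨inner ℝ e u, inner ℝ ν u⟩ hu

theorem dist_toUpperHalfPlane_coe_sq {ν e u v : E} (hu : 0 < inner ℝ ν u)
    (hv : 0 < inner ℝ ν v) :
    dist (toUpperHalfPlane ν e u hu : ℂ) (toUpperHalfPlane ν e v hv) ^ 2 =
      inner ℝ e (u - v) ^ 2 + inner ℝ ν (u - v) ^ 2 := by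
  rw [Complex.dist_eq, ← Complex.normSq_eq_norm_sq, Complex.normSq_apply, inner_sub_right,
    inner_sub_right]
  simp [toUpperHalfPlane]
  ring

/-- The projection keeps heights and, by Bessel, shrinks Euclidean distances. -/
theorem dist_toUpperHalfPlane_le {ν e u v : E} (hν : ‖ν‖ = 1) (he : ‖e‖ ≤ 1)
    (heν : inner ℝ e ν = 0) (hu : 0 < inner ℝ ν u) (hv : 0 < inner ℝ ν v) :
    dist (toUpperHalfPlane ν e u hu) (toUpperHalfPlane ν e v hv) ≤ halfSpaceDist ν u v := by
  rw [UpperHalfPlane.dist_eq, halfSpaceDist]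
  refine mul_le_mul_of_nonneg_left (Real.arsinh_le_arsinh.2 ?_) zero_le_two
  refine div_le_div_of_nonneg_right ?_ (by positivity)
  refine le_of_sq_le_sq ?_ (norm_nonneg _)
  rw [dist_toUpperHalfPlane_coe_sq]
  exact inner_sq_add_inner_sq_le hν he heν _

/-- For every pair of points there is a projection to the upper half-plane which preserves their
distances. -/
theorem exists_projection {ν : E} (hν : ‖ν‖ = 1) (u v : E) (hu : 0 < inner ℝ ν u)
    (hv : 0 < inner ℝ ν v) : ∃ e : E, ‖e‖ ≤ 1 ∧ inner ℝ e ν = 0 ∧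
      dist (toUpperHalfPlane ν e u hu : ℂ) (toUpperHalfPlane ν e v hv) = ‖u - v‖ ∧
      dist (toUpperHalfPlane ν e u hu) (toUpperHalfPlane ν e v hv) = halfSpaceDist ν u v := by
  obtain ⟨e, d, hd, heν, hsum, hcase⟩ := exists_horizontal ν hν (u - v)
  have key : dist (toUpperHalfPlane ν e u hu : ℂ) (toUpperHalfPlane ν e v hv) = ‖u - v‖ := by
    rw [← sq_eq_sq₀ dist_nonneg (norm_nonneg _), dist_toUpperHalfPlane_coe_sq]
    generalize u - v = x at *
    have h1 : inner ℝ e x = d * ‖e‖ ^ 2 := by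
      rw [hsum, inner_add_right, inner_smul_right, inner_smul_right, heν,
        real_inner_self_eq_norm_sq]
      ring
    have h2 : ‖x‖ ^ 2 = d ^ 2 * ‖e‖ ^ 2 + inner ℝ ν x ^ 2 := by
      conv_lhs => rw [hsum]
      rw [norm_add_sq_real, inner_smul_left, inner_smul_right, heν, norm_smul, norm_smul, hν,
        mul_pow, Real.norm_eq_abs, Real.norm_eq_abs, sq_abs, mul_one, sq_abs]
      simp
    rw [h1, h2]
    rcases hcase with ⟨h, h'⟩ | ⟨_, h'⟩
    · rw [h]; ring
    · rw [h']; ring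
  refine ⟨e, ?_, heν, key, ?_⟩
  · rcases hcase with ⟨_, h'⟩ | ⟨_, h'⟩
    · simp [h']
    · exact h'.le
  · rw [UpperHalfPlane.dist_eq, key]
    rfl

/-- A projection adapted to `u` and `w` preserves their distance and does not increase the other
two, so the inequality is inherited from the upper half-plane. -/
theorem halfSpaceDist_triangle {ν : E} (hν : ‖ν‖ = 1) {u v w : E} (hu : 0 < inner ℝ ν u)
    (hv : 0 < inner ℝ ν v) (hw : 0 < inner ℝ ν w) :
    halfSpaceDist ν u w ≤ halfSpaceDist ν u v + halfSpaceDist ν v w := by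
  obtain ⟨e, he, heν, -, h⟩ := exists_projection hν u w hu hw
  rw [← h]
  exact (dist_triangle _ (toUpperHalfPlane ν e v hv) _).trans
    (add_le_add (dist_toUpperHalfPlane_le hν he heν hu hv)
      (dist_toUpperHalfPlane_le hν he heν hv hw))

theorem halfSpaceDist_comm (ν u v : E) : halfSpaceDist ν u v = halfSpaceDist ν v u := by
  rw [halfSpaceDist, halfSpaceDist, norm_sub_rev, mul_comm (inner ℝ ν u : ℝ)]

theorem halfSpaceDist_le_div {ν : E} (hν : ‖ν‖ = 1) {u v : E} (hu : 0 < inner ℝ ν u)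
    (hv : 0 < inner ℝ ν v) :
    halfSpaceDist ν u v ≤ ‖u - v‖ / √(inner ℝ ν u * inner ℝ ν v) := by
  obtain ⟨e, he, heν, h1, h2⟩ := exists_projection hν u v hu hv
  rw [← h1, ← h2]
  exact UpperHalfPlane.dist_le_dist_coe_div_sqrt _ _

theorem norm_sub_le_of_halfSpaceDist {ν : E} (hν : ‖ν‖ = 1) {u v : E} (hu : 0 < inner ℝ ν u)
    (hv : 0 < inner ℝ ν v) :
    ‖u - v‖ ≤ inner ℝ ν u * (Real.exp (halfSpaceDist ν u v) - 1) := by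
  obtain ⟨e, he, heν, h1, h2⟩ := exists_projection hν u v hu hv
  rw [← h1, ← h2, dist_comm, dist_comm (toUpperHalfPlane ν e u hu)]
  exact UpperHalfPlane.dist_coe_le _ _

end HalfSpace

/-! ### Explicit geodesics of the half-space and their subdivision. -/

section Geodesic

variable {E : Type*} [NormedAddCommGroup E] [InnerProductSpace ℝ E]

/-- The `cosh` form of the distance has no square root, so checking that a parametrization is
isometric becomes an algebraic identity. -/
theorem halfSpaceDist_eq_abs {ν u v : E} (hu : 0 < inner ℝ ν u) (hv : 0 < inner ℝ ν v) {τ : ℝ}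
    (h : ‖u - v‖ ^ 2 = 2 * inner ℝ ν u * inner ℝ ν v * (Real.cosh τ - 1)) :
    halfSpaceDist ν u v = |τ| := by
  have hpos : 0 < (inner ℝ ν u * inner ℝ ν v : ℝ) := mul_pos hu hv
  have hs : 0 ≤ Real.sinh (|τ| / 2) := Real.sinh_nonneg_iff.2 (by positivity)
  have key : ‖u - v‖ / (2 * √(inner ℝ ν u * inner ℝ ν v)) = Real.sinh (|τ| / 2) := by
    rw [div_eq_iff (by positivity), ← sq_eq_sq₀ (norm_nonneg _) (by positivity), h, mul_pow,
      mul_pow, Real.sq_sqrt hpos.le]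
    have h2 : Real.cosh τ = 1 + 2 * Real.sinh (|τ| / 2) ^ 2 := by
      rw [← Real.cosh_abs τ]
      have := Real.cosh_two_mul (|τ| / 2)
      rw [mul_div_cancel₀ _ (two_ne_zero' ℝ), Real.cosh_sq] at this
      linarith
    rw [h2]
    ring
  rw [halfSpaceDist, key, Real.arsinh_sinh]
  ring

theorem tanh_le_tanh {s t : ℝ} (h : s ≤ t) :
    Real.sinh s / Real.cosh s ≤ Real.sinh t / Real.cosh t := by
  rw [div_le_div_iff₀ (Real.cosh_pos s) (Real.cosh_pos t), ← sub_nonneg]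
  have : 0 ≤ Real.sinh (t - s) := Real.sinh_nonneg_iff.2 (sub_nonneg.2 h)
  rw [Real.sinh_sub] at this
  linarith

theorem norm_sq_horizontal_add_vertical {ν h : E} (hν : ‖ν‖ = 1) (hh : inner ℝ h ν = 0) (y : ℝ) :
    ‖h + y • ν‖ ^ 2 = ‖h‖ ^ 2 + y ^ 2 := by
  rw [norm_add_sq_real, inner_smul_right, hh, norm_smul, hν, mul_one, Real.norm_eq_abs, sq_abs]
  ring

theorem inner_horizontal_add_vertical {ν h : E} (hν : ‖ν‖ = 1) (hh : inner ℝ h ν = 0) (y : ℝ) :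
    inner ℝ ν (h + y • ν) = y := by
  rw [inner_add_right, inner_smul_right, real_inner_comm, hh, real_inner_self_eq_norm_sq, hν]
  ring

/-- Geodesics of the half-space: vertical lines and half-circles. -/
theorem exists_geodesic {ν : E} (hν : ‖ν‖ = 1) {u v : E} (hu : 0 < inner ℝ ν u)
    (hv : 0 < inner ℝ ν v) : ∃ (p : ℝ → E) (t₀ t₁ : ℝ), p t₀ = u ∧ p t₁ = v ∧
      (∀ t, 0 < inner ℝ ν (p t)) ∧ (∀ s t, halfSpaceDist ν (p s) (p t) = |s - t|) ∧
      ∀ t ∈ uIcc t₀ t₁, ‖p t‖ ≤ max ‖u‖ ‖v‖ := by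
  obtain ⟨e, d, hd, heν, hsum, hcase⟩ := exists_horizontal ν hν (v - u)
  set y₀ : ℝ := inner ℝ ν u with hy₀
  set y₁ : ℝ := inner ℝ ν v with hy₁
  rw [inner_sub_right, ← hy₀, ← hy₁] at hsum
  set b := u - y₀ • ν with hb
  have hbν : inner ℝ b ν = 0 := by
    rw [hb, inner_sub_left, inner_smul_left, real_inner_self_eq_norm_sq, hν, real_inner_comm, ← hy₀]
    simp
  have hub : u = b + y₀ • ν := by rw [hb, sub_add_cancel]
  have hvb : v = b + d • e + y₁ • ν := by
    rw [← sub_add_cancel v u, hsum, hub, sub_smul]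
    abel
  rcases hcase with ⟨hd0, -⟩ | ⟨hdpos, he⟩
  · rw [hd0, zero_smul, add_zero] at hvb
    have hin : ∀ t, inner ℝ ν (b + Real.exp t • ν) = Real.exp t := fun t =>
      inner_horizontal_add_vertical hν hbν _
    have hpos : ∀ t, 0 < inner ℝ ν (b + Real.exp t • ν) := fun t => by
      rw [hin]; exact Real.exp_pos t
    refine ⟨fun t => b + Real.exp t • ν, Real.log y₀, Real.log y₁, ?_, ?_, hpos, ?_, ?_⟩
    · simp only [Real.exp_log hu, ← hub]
    · simp only [Real.exp_log hv, ← hvb]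
    · intro s t
      refine halfSpaceDist_eq_abs (hpos s) (hpos t) ?_
      rw [hin, hin, add_sub_add_left_eq_sub, ← sub_smul, norm_smul, hν, mul_one, Real.norm_eq_abs,
        sq_abs, Real.cosh_eq, Real.exp_neg, Real.exp_sub]
      have := Real.exp_pos s
      have := Real.exp_pos t
      field_simp
      ring
    · have key : ∀ s t, s ≤ t → ‖b + Real.exp s • ν‖ ≤ ‖b + Real.exp t • ν‖ := by
        intro s t hst
        rw [← sq_le_sq₀ (norm_nonneg _) (norm_nonneg _), norm_sq_horizontal_add_vertical hν hbν,
          norm_sq_horizontal_add_vertical hν hbν]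
        have := Real.exp_le_exp.2 hst
        have := Real.exp_pos s
        gcongr
      intro t ht
      rw [mem_uIcc] at ht
      rcases ht with ht | ht
      · refine (key _ _ ht.2).trans ?_
        rw [Real.exp_log hv, ← hvb]
        exact le_max_right _ _
      · refine (key _ _ ht.2).trans ?_
        rw [Real.exp_log hu, ← hub]
        exact le_max_left _ _
  -- The half-circle through `u` and `v` has its centre `b + c • e` on the boundary, equidistant
  -- from both, and is parametrized by `tanh` and `1 / cosh`.
  · set c : ℝ := (d ^ 2 + y₁ ^ 2 - y₀ ^ 2) / (2 * d) with hc
    set R : ℝ := √(c ^ 2 + y₀ ^ 2) with hR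
    have hRsq : R ^ 2 = c ^ 2 + y₀ ^ 2 := Real.sq_sqrt (by positivity)
    have hRsq' : R ^ 2 = (d - c) ^ 2 + y₁ ^ 2 := by
      rw [hRsq, hc]
      field_simp
      ring
    have hRpos : 0 < R := Real.sqrt_pos.2 (by positivity)
    set X : ℝ → ℝ := fun t => c + R * (Real.sinh t / Real.cosh t) with hX
    set Y : ℝ → ℝ := fun t => R / Real.cosh t with hY
    have hYpos : ∀ t, 0 < Y t := fun t => div_pos hRpos (Real.cosh_pos t)
    have hbX : ∀ t, inner ℝ (b + X t • e) ν = 0 := fun t => by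
      rw [inner_add_left, inner_smul_left, hbν, heν]; simp
    have hin : ∀ t, inner ℝ ν (b + X t • e + Y t • ν) = Y t := fun t =>
      inner_horizontal_add_vertical hν (hbX t) _
    have hpos : ∀ t, 0 < inner ℝ ν (b + X t • e + Y t • ν) := fun t => by
      rw [hin]; exact hYpos t
    -- At the point with coordinates `(x, y)` the parameter satisfies `sinh t = (x - c) / y`.
    have hpt : ∀ x y, 0 < y → R ^ 2 = (x - c) ^ 2 + y ^ 2 →
        X (Real.arsinh ((x - c) / y)) = x ∧ Y (Real.arsinh ((x - c) / y)) = y := by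
      intro x y hy h
      have hcosh : Real.cosh (Real.arsinh ((x - c) / y)) = R / y := by
        rw [Real.cosh_arsinh, ← Real.sqrt_sq (div_pos hRpos hy).le]
        congr 1
        rw [div_pow, div_pow, h]
        field_simp
        ring
      simp only [hX, hY, hcosh, Real.sinh_arsinh]
      constructor
      · field_simp
        ring
      · field_simp
    obtain ⟨hX0, hY0⟩ := hpt 0 y₀ hu (by rw [hRsq]; ring)
    obtain ⟨hX1, hY1⟩ := hpt d y₁ hv hRsq'
    have hp0 : b + X (Real.arsinh ((0 - c) / y₀)) • e + Y (Real.arsinh ((0 - c) / y₀)) • ν = u := by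
      rw [hX0, hY0, zero_smul, add_zero, ← hub]
    have hp1 : b + X (Real.arsinh ((d - c) / y₁)) • e + Y (Real.arsinh ((d - c) / y₁)) • ν = v := by
      rw [hX1, hY1, ← hvb]
    refine ⟨fun t => b + X t • e + Y t • ν, Real.arsinh ((0 - c) / y₀),
      Real.arsinh ((d - c) / y₁), hp0, hp1, hpos, ?_, ?_⟩
    · intro s t
      refine halfSpaceDist_eq_abs (hpos s) (hpos t) ?_
      have h1 : b + X s • e + Y s • ν - (b + X t • e + Y t • ν) =
          (X s - X t) • e + (Y s - Y t) • ν := by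
        rw [sub_smul, sub_smul]; abel
      rw [hin, hin, h1, norm_sq_horizontal_add_vertical hν (by
        rw [inner_smul_left, heν, mul_zero]), norm_smul, he, mul_one, Real.norm_eq_abs, sq_abs,
        Real.cosh_sub]
      simp only [hX, hY]
      have hs := Real.cosh_sq s
      have ht := Real.cosh_sq t
      have hs' := Real.cosh_pos s
      have ht' := Real.cosh_pos t
      generalize Real.cosh s = C at *
      generalize Real.cosh t = C' at *
      generalize Real.sinh s = S at *
      generalize Real.sinh t = S' at *
      field_simp
      linear_combination (-C' ^ 2 * R ^ 2) * hs - C ^ 2 * R ^ 2 * ht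
    -- Along the half-circle the squared norm is affine in `tanh t`, hence monotone, so its maximum
    -- over an arc is at an end. This later keeps geodesics within the range of the chart.
    · have hnorm : ∀ t, ‖b + X t • e + Y t • ν‖ ^ 2 =
          (‖b‖ ^ 2 + 2 * c * inner ℝ b e + c ^ 2 + R ^ 2) +
            (2 * R * inner ℝ b e + 2 * c * R) * (Real.sinh t / Real.cosh t) := by
        intro t
        rw [norm_sq_horizontal_add_vertical hν (hbX t), norm_add_sq_real, inner_smul_right,
          norm_smul, he, mul_one, Real.norm_eq_abs, sq_abs]
        simp only [hX, hY]
        have ht := Real.cosh_sq t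
        have ht' := Real.cosh_pos t
        generalize Real.cosh t = C' at *
        generalize Real.sinh t = S' at *
        field_simp
        linear_combination (-R ^ 2) * ht
      intro t ht
      rw [← hp0, ← hp1, le_max_iff, ← sq_le_sq₀ (norm_nonneg _) (norm_nonneg _),
        ← sq_le_sq₀ (norm_nonneg _) (norm_nonneg _), hnorm, hnorm, hnorm]
      simp only [add_le_add_iff_left]
      generalize 2 * R * inner ℝ b e + 2 * c * R = B
      rcases le_total 0 B with hB | hB <;> rcases mem_uIcc.1 ht with ht | ht
      · exact Or.inr (mul_le_mul_of_nonneg_left (tanh_le_tanh ht.2) hB)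
      · exact Or.inl (mul_le_mul_of_nonneg_left (tanh_le_tanh ht.2) hB)
      · exact Or.inl (mul_le_mul_of_nonpos_left (tanh_le_tanh ht.1) hB)
      · exact Or.inr (mul_le_mul_of_nonpos_left (tanh_le_tanh ht.1) hB)

/-- Subdivision of a geodesic of the half-space into `N` equal parts. -/
theorem exists_chain {ν : E} (hν : ‖ν‖ = 1) {u v : E} (hu : 0 < inner ℝ ν u)
    (hv : 0 < inner ℝ ν v) {N : ℕ} (hN : 0 < N) : ∃ q : ℕ → E, q 0 = u ∧ q N = v ∧
      ∀ i ≤ N, 0 < inner ℝ ν (q i) ∧ ‖q i‖ ≤ max ‖u‖ ‖v‖ ∧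
        halfSpaceDist ν (q i) (q (i + 1)) = halfSpaceDist ν u v / N := by
  obtain ⟨p, t₀, t₁, h0, h1, hpos, hdist, hnorm⟩ := exists_geodesic hν hu hv
  have hN' : (0 : ℝ) < N := Nat.cast_pos.2 hN
  -- The geodesic is defined for all parameters, so the step from `i = N` beyond `v` also has the
  -- right length.
  refine ⟨fun i => p (t₀ + i / N * (t₁ - t₀)), by simp [h0], by simp [hN'.ne', h1],
    fun i hi => ⟨hpos _, hnorm _ ?_, ?_⟩⟩
  · have hi0 : (0 : ℝ) ≤ i / N := by positivity
    have hi1 : (i : ℝ) / N ≤ 1 := (div_le_one hN').2 (Nat.cast_le.2 hi)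
    rw [mem_uIcc]
    rcases le_total t₀ t₁ with h | h
    · left; constructor <;> nlinarith
    · right; constructor <;> nlinarith
  · rw [hdist, ← h0, ← h1, hdist, Nat.cast_succ]
    have : t₀ + i / N * (t₁ - t₀) - (t₀ + ((i : ℝ) + 1) / N * (t₁ - t₀)) = (t₀ - t₁) / N := by
      field_simp
      ring
    rw [this, abs_div, abs_of_pos hN']

end Geodesic

/-! ### Flattening a `C¹` boundary. -/

section Chart

variable {n : ℕ} {D : Set (EuclideanSpace ℝ (Fin n))} {a : EuclideanSpace ℝ (Fin n)}

/-- A `K`-bi-Lipschitz chart of a neighbourhood of the boundary point `a`, taking `D` to the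
half-space `⟪ν, ·⟫ > 0` and almost preserving the distance to the boundary. -/
structure IsBoundaryChart (D : Set (EuclideanSpace ℝ (Fin n))) (a : EuclideanSpace ℝ (Fin n))
    (K : ℝ) (ν : EuclideanSpace ℝ (Fin n))
    (F : EuclideanSpace ℝ (Fin n) → EuclideanSpace ℝ (Fin n)) (ρ : ℝ) : Prop where
  norm_normal : ‖ν‖ = 1
  radius_pos : 0 < ρ
  map_center : F a = 0
  norm_map_le : ∀ x ∈ Metric.ball a ρ, ∀ y ∈ Metric.ball a ρ, ‖F x - F y‖ ≤ K * ‖x - y‖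
  norm_le_map : ∀ x ∈ Metric.ball a ρ, ∀ y ∈ Metric.ball a ρ, ‖x - y‖ ≤ K * ‖F x - F y‖
  mem_iff : ∀ x ∈ Metric.ball a ρ, x ∈ D ↔ 0 < inner ℝ ν (F x)
  height_le : ∀ x ∈ Metric.ball a ρ, x ∈ D → inner ℝ ν (F x) ≤ K * bdryDist D x
  le_height : ∀ x ∈ Metric.ball a ρ, x ∈ D → bdryDist D x ≤ K * inner ℝ ν (F x)
  surj : ∀ q, ‖q‖ < ρ / K → ∃ x ∈ Metric.ball a ρ, F x = q

theorem eq_zero_of_mem_frontier (hDo : IsOpen D) {U : Set (EuclideanSpace ℝ (Fin n))}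
    {r : EuclideanSpace ℝ (Fin n) → ℝ} (hU : IsOpen U) (hr : ContinuousOn r U)
    (hDU : D ∩ U = {x ∈ U | 0 < r x}) {p : EuclideanSpace ℝ (Fin n)} (hp : p ∈ frontier D)
    (hpU : p ∈ U) : r p = 0 := by
  rw [hDo.frontier_eq] at hp
  refine le_antisymm (not_lt.1 fun h => hp.2 ?_) (not_lt.1 fun h => ?_)
  · have : p ∈ D ∩ U := hDU ▸ ⟨hpU, h⟩
    exact this.1
  · have h1 : ∀ᶠ x in 𝓝 p, x ∈ U ∧ r x < 0 :=
      (hU.eventually_mem hpU).and ((hr.continuousAt (hU.mem_nhds hpU)).eventually_lt_const h)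
    obtain ⟨x, hx, hxD⟩ := mem_closure_iff_nhds.1 hp.1 _ h1
    have : x ∈ {x ∈ U | 0 < r x} := hDU ▸ ⟨hxD, hx.1⟩
    exact absurd this.2 (not_lt.2 hx.2.le)

/-- Dividing `r` by `‖∇r(a)‖` makes its gradient at `a` a unit normal. -/
theorem exists_normalized_defining_function (ha : IsC1BoundaryPoint D a) :
    ∃ (U : Set (EuclideanSpace ℝ (Fin n))) (r : EuclideanSpace ℝ (Fin n) → ℝ)
      (ν : EuclideanSpace ℝ (Fin n)), IsOpen U ∧ a ∈ U ∧ ContinuousOn r U ∧ ‖ν‖ = 1 ∧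
      HasStrictFDerivAt r (innerSL ℝ ν) a ∧ D ∩ U = {x ∈ U | 0 < r x} := by
  obtain ⟨-, U, r, hU, haU, hr, hr', hDU⟩ := ha
  set g := (InnerProductSpace.toDual ℝ (EuclideanSpace ℝ (Fin n))).symm (fderiv ℝ r a) with hg
  have hg0 : g ≠ 0 := by
    rw [hg, Ne, LinearIsometryEquiv.map_eq_zero_iff]
    exact hr'
  have hn : 0 < ‖g‖ := norm_pos_iff.2 hg0
  have hstrict : HasStrictFDerivAt r (fderiv ℝ r a) a :=
    (hr.contDiffAt (hU.mem_nhds haU)).hasStrictFDerivAt one_ne_zero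
  refine ⟨U, fun x => ‖g‖⁻¹ * r x, ‖g‖⁻¹ • g, hU, haU, continuousOn_const.mul hr.continuousOn,
    by rw [norm_smul, norm_inv, norm_norm, inv_mul_cancel₀ hn.ne'], ?_, ?_⟩
  · have e : innerSL ℝ (‖g‖⁻¹ • g) = ‖g‖⁻¹ • fderiv ℝ r a := by
      ext x
      have : fderiv ℝ r a x = inner ℝ g x := by
        rw [hg, InnerProductSpace.toDual_symm_apply]
      rw [innerSL_apply_apply, inner_smul_left, _root_.smul_apply, this]
      rfl
    rw [e]
    exact hstrict.const_mul ‖g‖⁻¹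
  · rw [hDU]
    ext x
    simp only [mem_ofPred_eq, mul_pos_iff_of_pos_left (inv_pos.2 hn)]

/-- `F x` is `x - a` with its height replaced by `r x`. The deviation of `F` from a translation is
the error of linearizing `r` at `a`, times `ν`; strict differentiability makes it Lipschitz with an
arbitrarily small constant. -/
theorem exists_isBoundaryChart (hDo : IsOpen D) (ha : IsC1BoundaryPoint D a) {K : ℝ}
    (hK : 1 < K) : ∃ ν F ρ, IsBoundaryChart D a K ν F ρ := by
  have hK0 : 0 < K := zero_lt_one.trans hK
  obtain ⟨U, r, ν, hU, haU, hr, hν, hr', hDU⟩ := exists_normalized_defining_function ha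
  have hra : r a = 0 := eq_zero_of_mem_frontier hDo hU hr hDU ha.1 haU
  -- With this `c`, `1 - c = 1 / K` and `1 + c ≤ K`, which are the two bi-Lipschitz bounds.
  set c : ℝ := 1 - 1 / K with hc
  have hc0 : 0 < c := by rw [hc, sub_pos, div_lt_one hK0]; exact hK
  obtain ⟨c', hc'⟩ : ∃ c' : NNReal, (c' : ℝ) = c := ⟨c.toNNReal, Real.coe_toNNReal _ hc0.le⟩
  obtain ⟨s, hs, happ⟩ := hr'.approximates_deriv_on_nhds (c := c')
    (Or.inr (NNReal.coe_pos.1 (hc' ▸ hc0)))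
  obtain ⟨ρ₀, hρ₀, hball⟩ := Metric.mem_nhds_iff.1 (inter_mem hs (hU.mem_nhds haU))
  set F : EuclideanSpace ℝ (Fin n) → EuclideanSpace ℝ (Fin n) :=
    fun x => (x - a) + (r x - inner ℝ ν (x - a)) • ν with hF
  have hνν : inner ℝ ν ν = (1 : ℝ) := by rw [real_inner_self_eq_norm_sq, hν, one_pow]
  have hνF : ∀ x, inner ℝ ν (F x) = r x := fun x => by
    rw [hF, inner_add_right, inner_smul_right, hνν]; ring
  have hFa : F a = 0 := by simp [hF, hra]
  have hdiff : ∀ x ∈ Metric.ball a ρ₀, ∀ y ∈ Metric.ball a ρ₀,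
      ‖F x - F y - (x - y)‖ ≤ c * ‖x - y‖ := by
    intro x hx y hy
    have h1 : F x - F y - (x - y) = (r x - r y - inner ℝ ν (x - y)) • ν := by
      have : (inner ℝ ν (x - y) : ℝ) = inner ℝ ν (x - a) - inner ℝ ν (y - a) := by
        rw [← inner_sub_right, sub_sub_sub_cancel_right]
      simp only [hF]
      rw [this]
      generalize (inner ℝ ν (x - a) : ℝ) = A
      generalize (inner ℝ ν (y - a) : ℝ) = B
      rw [sub_smul, sub_smul, sub_smul, sub_smul, sub_smul]
      abel
    rw [h1, norm_smul, hν, mul_one]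
    rw [← hc']
    exact happ x (hball hx).1 y (hball hy).1
  have hup : ∀ x ∈ Metric.ball a ρ₀, ∀ y ∈ Metric.ball a ρ₀, ‖F x - F y‖ ≤ K * ‖x - y‖ := by
    intro x hx y hy
    have h1 := norm_le_norm_add_norm_sub' (F x - F y) (x - y)
    have h2 := hdiff x hx y hy
    have h3 : 1 + c ≤ K := by
      rw [hc]
      have : 0 ≤ (K - 1) ^ 2 / K := by positivity
      have e : (K - 1) ^ 2 / K = K - 2 + 1 / K := by field_simp; ring
      linarith
    nlinarith [norm_nonneg (x - y)]
  have hlo : ∀ x ∈ Metric.ball a ρ₀, ∀ y ∈ Metric.ball a ρ₀, ‖x - y‖ ≤ K * ‖F x - F y‖ := by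
    intro x hx y hy
    have h1 := norm_le_norm_add_norm_sub (F x - F y) (x - y)
    have h2 := hdiff x hx y hy
    have h3 : 1 / K * ‖x - y‖ ≤ ‖F x - F y‖ := by
      have : 1 / K = 1 - c := by rw [hc]; ring
      rw [this]
      linarith
    rw [one_div, inv_mul_le_iff₀ hK0] at h3
    exact h3
  have hsurj : ∀ q, ‖q‖ ≤ ρ₀ / (2 * K) → ∃ x ∈ Metric.ball a ρ₀, F x = q := by
    intro q hq
    have happF : ApproximatesLinearOn F
        (ContinuousLinearMap.id ℝ (EuclideanSpace ℝ (Fin n))) (Metric.ball a ρ₀)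
        c' := fun x hx y hy => by rw [hc']; exact hdiff x hx y hy
    let R : (ContinuousLinearMap.id ℝ (EuclideanSpace ℝ (Fin n))).NonlinearRightInverse :=
      { toFun := id, nnnorm := 1, bound' := fun y => by simp, right_inv' := fun y => rfl }
    have hsub : Metric.closedBall a (ρ₀ / 2) ⊆ Metric.ball a ρ₀ :=
      Metric.closedBall_subset_ball (by linarith)
    -- The image of the closed ball of radius `ρ₀ / 2` contains the one of radius `(1 - c) * (ρ₀ /
    -- 2) = ρ₀ / (2 * K)`.
    have := happF.surjOn_closedBall_of_nonlinearRightInverse R (by positivity) hsub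
    obtain ⟨x, hx, hxq⟩ := this (show q ∈ _ by
      rw [hFa, mem_closedBall_zero_iff]
      refine hq.trans_eq ?_
      have : (R.nnnorm : ℝ)⁻¹ - c' = 1 / K := by
        rw [hc', hc]
        simp [R]
      rw [this]
      field_simp)
    exact ⟨x, hsub hx, hxq⟩
  have hmem : ∀ x ∈ Metric.ball a ρ₀, x ∈ D ↔ 0 < inner ℝ ν (F x) := by
    intro x hx
    rw [hνF]
    have hxU := (hball hx).2
    constructor
    · intro h
      have : x ∈ {x ∈ U | 0 < r x} := hDU ▸ ⟨h, hxU⟩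
      exact this.2
    · intro h
      have : x ∈ D ∩ U := hDU ▸ ⟨hxU, h⟩
      exact this.1
  have haB : a ∈ Metric.ball a ρ₀ := Metric.mem_ball_self hρ₀
  -- Then `K * ρ = ρ₀ / (2 * K)`, so `F` maps the ball of radius `ρ` into the range covered by
  -- `hsurj`.
  set ρ := ρ₀ / (2 * K ^ 2) with hρ
  have hρpos : 0 < ρ := by positivity
  have hρle : ρ ≤ ρ₀ / 2 := by
    rw [hρ]
    refine div_le_div_of_nonneg_left hρ₀.le two_pos ?_
    nlinarith
  have hsubB : Metric.ball a ρ ⊆ Metric.ball a ρ₀ := Metric.ball_subset_ball (by linarith)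
  refine ⟨ν, F, ρ, hν, hρpos, hFa, fun x hx y hy => hup x (hsubB hx) y (hsubB hy),
    fun x hx y hy => hlo x (hsubB hx) y (hsubB hy), fun x hx => hmem x (hsubB hx), ?_, ?_, ?_⟩
  · intro x hx hxD
    rw [← div_le_iff₀' hK0]
    refine (Metric.le_infDist ⟨a, ha.1⟩).2 fun p hp => ?_
    rw [div_le_iff₀' hK0, dist_eq_norm]
    by_cases hpB : p ∈ Metric.ball a ρ₀
    · have hrp : inner ℝ ν (F p) = (0 : ℝ) := by
        rw [hνF]; exact eq_zero_of_mem_frontier hDo hU hr hDU hp (hball hpB).2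
      calc inner ℝ ν (F x) = inner ℝ ν (F x - F p) := by rw [inner_sub_right, hrp, sub_zero]
        _ ≤ ‖ν‖ * ‖F x - F p‖ := real_inner_le_norm _ _
        _ ≤ K * ‖x - p‖ := by rw [hν, one_mul]; exact hup x (hsubB hx) p hpB
    -- A boundary point outside the large ball is farther from `x` than `a` is.
    · have h1 : ‖x - a‖ ≤ ‖x - p‖ := by
        rw [Metric.mem_ball, not_lt, dist_eq_norm] at hpB
        rw [Metric.mem_ball, dist_eq_norm] at hx
        have := norm_sub_le_norm_sub_add_norm_sub p x a
        rw [norm_sub_rev p x] at this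
        linarith
      calc inner ℝ ν (F x) ≤ ‖ν‖ * ‖F x‖ := real_inner_le_norm _ _
        _ = ‖F x - F a‖ := by rw [hν, one_mul, hFa, sub_zero]
        _ ≤ K * ‖x - a‖ := hup x (hsubB hx) a haB
        _ ≤ K * ‖x - p‖ := mul_le_mul_of_nonneg_left h1 hK0.le
  · intro x hx hxD
    -- The vertical foot of `F x` on the hyperplane is the image of a point outside `D`, which
    -- bounds `d_D(x)`.
    set y : ℝ := inner ℝ ν (F x) with hy
    have hy0 : 0 < y := (hmem x (hsubB hx)).1 hxD
    have hq : ‖F x - y • ν‖ ≤ ρ₀ / (2 * K) := by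
      have h1 : ‖F x - y • ν‖ ^ 2 ≤ ‖F x‖ ^ 2 := by
        rw [norm_sub_sq_real, inner_smul_right, real_inner_comm, ← hy, norm_smul, hν, mul_one,
          Real.norm_eq_abs, sq_abs]
        nlinarith
      have h2 := le_of_sq_le_sq h1 (norm_nonneg _)
      have h3 := hup x (hsubB hx) a haB
      rw [hFa, sub_zero] at h3
      rw [Metric.mem_ball, dist_eq_norm] at hx
      calc ‖F x - y • ν‖ ≤ K * ρ := h2.trans (h3.trans (mul_le_mul_of_nonneg_left hx.le hK0.le))
        _ = ρ₀ / (2 * K) := by rw [hρ]; field_simp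
    obtain ⟨p, hpB, hFp⟩ := hsurj _ hq
    have hpD : p ∉ D := by
      rw [hmem p hpB, hFp, inner_sub_right, inner_smul_right, hνν, ← hy]
      simp
    refine (bdryDist_le_of_notMem hxD hpD).trans ((hlo x (hsubB hx) p hpB).trans_eq ?_)
    rw [hFp, sub_sub_cancel, norm_smul, hν, mul_one, Real.norm_of_nonneg hy0.le]
  · intro q hq
    have hq' : ‖q‖ ≤ ρ₀ / (2 * K) := by
      refine hq.le.trans ((div_le_div_of_nonneg_right hρle hK0.le).trans_eq ?_)
      field_simp
    obtain ⟨x, hx, hFx⟩ := hsurj q hq'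
    refine ⟨x, ?_, hFx⟩
    have := hlo x hx a haB
    rw [hFa, sub_zero, hFx] at this
    rw [Metric.mem_ball, dist_eq_norm]
    rw [lt_div_iff₀' hK0] at hq
    exact this.trans_lt hq

end Chart

/-! ### Inequalities for `arsinh`. -/

section RealEstimates

/-- This is concavity of `arsinh` on `[0, ∞)` together with `arsinh 0 = 0`. It turns a factor in the
argument into a factor of the distance. -/
theorem arsinh_mul_le {c x : ℝ} (hc : 1 ≤ c) (hx : 0 ≤ x) :
    Real.arsinh (c * x) ≤ c * Real.arsinh x := by
  have hd : ∀ y, HasDerivAt (fun y => c * Real.arsinh y - Real.arsinh (c * y))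
      (c * (√(1 + y ^ 2))⁻¹ - (√(1 + (c * y) ^ 2))⁻¹ * c) y := fun y =>
    ((Real.hasDerivAt_arsinh y).const_mul c).sub
      ((Real.hasDerivAt_arsinh (c * y)).comp y (by simpa using (hasDerivAt_id y).const_mul c))
  have hmono : Monotone fun y => c * Real.arsinh y - Real.arsinh (c * y) := by
    refine monotone_of_deriv_nonneg (fun y => (hd y).differentiableAt) fun y => ?_
    rw [(hd y).deriv, mul_comm _ c, ← mul_sub]
    refine mul_nonneg (by linarith) (sub_nonneg.2 ?_)
    refine inv_anti₀ (by positivity) (Real.sqrt_le_sqrt ?_)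
    rw [mul_pow]
    nlinarith [sq_nonneg y, mul_self_nonneg (c - 1)]
  have := hmono hx
  simp only [mul_zero, Real.arsinh_zero, sub_zero] at this
  linarith

theorem log_two_mul_le_arsinh {x : ℝ} (hx : 0 < x) : Real.log (2 * x) ≤ Real.arsinh x := by
  rw [Real.arsinh]
  refine Real.log_le_log (by positivity) ?_
  have : x ≤ √(1 + x ^ 2) := Real.le_sqrt_of_sq_le (by linarith)
  linarith

theorem arsinh_half_le_log {x : ℝ} (hx : 0 ≤ x) : Real.arsinh (x / 2) ≤ Real.log (1 + x) := by
  rw [Real.arsinh]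
  have h : √(1 + (x / 2) ^ 2) ≤ 1 + x / 2 := by
    rw [Real.sqrt_le_left (by positivity)]
    nlinarith
  refine Real.log_le_log ?_ (by linarith)
  have : 0 < √(1 + (x / 2) ^ 2) := by positivity
  positivity

/-- With `two_mul_arsinh_le`, this replaces `s_D` by `log (1 / p) + log (1 / q)` up to constants
when `s` is bounded above and below and `p`, `q` are bounded above. -/
theorem le_two_mul_arsinh {m s p q : ℝ} (hm : 0 < m) (hs : m ≤ s) (hp : 0 < p) (hq : 0 < q) :
    2 * Real.log m - Real.log p - Real.log q ≤ 2 * Real.arsinh (s / (2 * √(p * q))) := by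
  have hs0 : 0 < s := hm.trans_le hs
  have hpq : 0 < p * q := mul_pos hp hq
  have h1 := log_two_mul_le_arsinh (x := s / (2 * √(p * q))) (by positivity)
  have h2 : 2 * (s / (2 * √(p * q))) = s / √(p * q) := by field_simp
  rw [h2, Real.log_div hs0.ne' (Real.sqrt_pos.2 hpq).ne', Real.log_sqrt hpq.le,
    Real.log_mul hp.ne' hq.ne'] at h1
  have h3 := Real.log_le_log hm hs
  linarith

theorem two_mul_arsinh_le {M s p q : ℝ} (hs : 0 ≤ s) (hp : 0 < p) (hq : 0 < q)
    (hM : √(p * q) + s ≤ M) :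
    2 * Real.arsinh (s / (2 * √(p * q))) ≤ 2 * Real.log M - Real.log p - Real.log q := by
  have hpq : 0 < p * q := mul_pos hp hq
  have hr : 0 < √(p * q) := Real.sqrt_pos.2 hpq
  have h1 := arsinh_half_le_log (x := s / √(p * q)) (by positivity)
  have h2 : s / √(p * q) / 2 = s / (2 * √(p * q)) := by rw [div_div, mul_comm]
  have h3 : 1 + s / √(p * q) = (√(p * q) + s) / √(p * q) := by field_simp
  rw [h2, h3, Real.log_div (by positivity) hr.ne', Real.log_sqrt hpq.le,
    Real.log_mul hp.ne' hq.ne'] at h1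
  have h4 := Real.log_le_log (by positivity) hM
  linarith

theorem div_sqrt_le {K s s' p p' q q' : ℝ} (hK : 0 < K) (hs : s ≤ K * s') (hs' : 0 ≤ s')
    (hp : 0 < p) (hp' : 0 < p') (hq : 0 < q) (hq' : 0 < q') (hpp : p' ≤ K * p)
    (hqq : q' ≤ K * q) : s / √(p * q) ≤ K ^ 2 * (s' / √(p' * q')) := by
  have h1 : √(p' * q') ≤ K * √(p * q) := by
    rw [Real.sqrt_le_left (by positivity), mul_pow, Real.sq_sqrt (by positivity)]
    calc p' * q' ≤ (K * p) * (K * q) := by gcongr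
      _ = _ := by ring
  have h2 : 0 < √(p' * q') := by positivity
  have h3 : 0 < √(p * q) := by positivity
  rw [← mul_div_assoc, div_le_div_iff₀ h3 h2]
  calc s * √(p' * q') ≤ (K * s') * (K * √(p * q)) :=
        mul_le_mul hs h1 h2.le (by positivity)
    _ = _ := by ring

theorem two_mul_arsinh_le_mul {K s s' p p' q q' : ℝ} (hK : 1 < K) (hs : s ≤ K * s')
    (hs' : 0 ≤ s') (hp : 0 < p) (hp' : 0 < p') (hq : 0 < q) (hq' : 0 < q') (hpp : p' ≤ K * p)
    (hqq : q' ≤ K * q) : 2 * Real.arsinh (s / (2 * √(p * q))) ≤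
      K ^ 2 * (2 * Real.arsinh (s' / (2 * √(p' * q')))) := by
  have h := div_sqrt_le (zero_lt_one.trans hK) hs hs' hp hp' hq hq' hpp hqq
  have h1 : s / (2 * √(p * q)) ≤ K ^ 2 * (s' / (2 * √(p' * q'))) := by
    rw [mul_comm 2, mul_comm 2, ← div_div, ← div_div, ← mul_div_assoc]
    linarith
  have h2 := (Real.arsinh_le_arsinh.2 h1).trans
    (arsinh_mul_le (by nlinarith : 1 ≤ K ^ 2) (by positivity))
  linarith

end RealEstimates

/-! ### Quasi-hyperbolic length inside a chart. -/

section Local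

variable {n : ℕ} {D : Set (EuclideanSpace ℝ (Fin n))} {a z w : EuclideanSpace ℝ (Fin n)}

theorem sinhDist_nonneg : 0 ≤ sinhDist D z w :=
  mul_nonneg zero_le_two (Real.arsinh_nonneg_iff.2 (by positivity))

theorem sinhDist_pos (hz : 0 < bdryDist D z) (hw : 0 < bdryDist D w) (h : z ≠ w) :
    0 < sinhDist D z w := by
  have := norm_pos_iff.2 (sub_ne_zero.2 h)
  exact mul_pos two_pos (Real.arsinh_pos_iff.2 (by positivity))

variable {K ρ : ℝ} {ν : EuclideanSpace ℝ (Fin n)}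
  {F : EuclideanSpace ℝ (Fin n) → EuclideanSpace ℝ (Fin n)}

theorem qhEDist_self (hz : z ∈ D) (hd : 0 < bdryDist D z) : qhEDist D z z = 0 := by
  have := qhEDist_le_of_norm_sub_lt (w := z) hz (by simpa using hd)
  simpa using this

namespace IsBoundaryChart

variable (h : IsBoundaryChart D a K ν F ρ)
include h

theorem halfSpaceDist_le (hK : 1 < K) (hd : ∀ u ∈ D, 0 < bdryDist D u)
    (hz : z ∈ Metric.ball a ρ) (hzD : z ∈ D) (hw : w ∈ Metric.ball a ρ) (hwD : w ∈ D) :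
    halfSpaceDist ν (F z) (F w) ≤ K ^ 2 * sinhDist D z w :=
  two_mul_arsinh_le_mul hK (h.norm_map_le z hz w hw) (norm_nonneg _) ((h.mem_iff z hz).1 hzD)
    (hd z hzD) ((h.mem_iff w hw).1 hwD) (hd w hwD) (h.le_height z hz hzD) (h.le_height w hw hwD)

theorem le_halfSpaceDist (hK : 1 < K) (hd : ∀ u ∈ D, 0 < bdryDist D u)
    (hz : z ∈ Metric.ball a ρ) (hzD : z ∈ D) (hw : w ∈ Metric.ball a ρ) (hwD : w ∈ D) :
    sinhDist D z w ≤ K ^ 2 * halfSpaceDist ν (F z) (F w) :=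
  two_mul_arsinh_le_mul hK (h.norm_le_map z hz w hw) (norm_nonneg _) (hd z hzD)
    ((h.mem_iff z hz).1 hzD) (hd w hwD) ((h.mem_iff w hw).1 hwD) (h.height_le z hz hzD)
    (h.height_le w hw hwD)

end IsBoundaryChart

/-- Here `δ = K ^ 2 * (exp τ - 1)` bounds `‖z - w‖ / d_D(z)` for points at half-space distance `τ`,
and `δ / (1 - δ)` is the cost of the segment. To first order this is `K ^ 2 * τ`; the extra factor
`K` absorbs the rest. -/
theorem exists_step_bound {K : ℝ} (hK : 1 < K) : ∃ τ₀ > 0, ∀ τ, 0 ≤ τ → τ < τ₀ →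
    K ^ 2 * (Real.exp τ - 1) < 1 ∧
    K ^ 2 * (Real.exp τ - 1) / (1 - K ^ 2 * (Real.exp τ - 1)) ≤ K ^ 3 * τ := by
  have hK0 : 0 < K := zero_lt_one.trans hK
  have hc1 : ContinuousAt (fun τ : ℝ => K ^ 2 * (Real.exp τ - 1)) 0 := by fun_prop
  have hc2 : ContinuousAt (fun τ : ℝ => Real.exp τ / (1 - K ^ 2 * (Real.exp τ - 1))) 0 := by
    refine ContinuousAt.div Real.continuous_exp.continuousAt (continuousAt_const.sub hc1) ?_
    simp
  have e1 := hc1.eventually_lt_const (u := 1) (by simp)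
  have e2 := hc2.eventually_lt_const (u := K) (by simpa using hK)
  obtain ⟨τ₀, hτ₀, hb⟩ := Metric.eventually_nhds_iff.1 (e1.and e2)
  refine ⟨τ₀, hτ₀, fun τ h0 hτ => ?_⟩
  obtain ⟨h1, h2⟩ := hb (show dist τ 0 < τ₀ by rwa [Real.dist_eq, sub_zero, abs_of_nonneg h0])
  refine ⟨h1, ?_⟩
  have hpos : 0 < 1 - K ^ 2 * (Real.exp τ - 1) := sub_pos.2 h1
  have hexp : Real.exp τ - 1 ≤ τ * Real.exp τ := by
    have := mul_le_mul_of_nonneg_right (Real.add_one_le_exp (-τ)) (Real.exp_pos τ).le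
    rw [← Real.exp_add, neg_add_cancel, Real.exp_zero] at this
    linarith
  calc K ^ 2 * (Real.exp τ - 1) / (1 - K ^ 2 * (Real.exp τ - 1))
      ≤ K ^ 2 * (τ * Real.exp τ) / (1 - K ^ 2 * (Real.exp τ - 1)) := by gcongr
    _ = K ^ 2 * τ * (Real.exp τ / (1 - K ^ 2 * (Real.exp τ - 1))) := by ring
    _ ≤ K ^ 2 * τ * K := by gcongr
    _ = K ^ 3 * τ := by ring

namespace IsBoundaryChart

variable (h : IsBoundaryChart D a K ν F ρ)
include h

theorem qhEDist_step_le (hK : 1 < K) (hd : ∀ u ∈ D, 0 < bdryDist D u)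
    (hz : z ∈ Metric.ball a ρ) (hw : w ∈ Metric.ball a ρ) (hzD : z ∈ D) (hwD : w ∈ D) {τ : ℝ}
    (hτ : halfSpaceDist ν (F z) (F w) = τ) (hτ1 : K ^ 2 * (Real.exp τ - 1) < 1)
    (hτ2 : K ^ 2 * (Real.exp τ - 1) / (1 - K ^ 2 * (Real.exp τ - 1)) ≤ K ^ 3 * τ) :
    qhEDist D z w ≤ ENNReal.ofReal (K ^ 3 * τ) := by
  have hK0 : 0 < K := zero_lt_one.trans hK
  have hdz := hd z hzD
  have h1 := norm_sub_le_of_halfSpaceDist h.norm_normal ((h.mem_iff z hz).1 hzD)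
    ((h.mem_iff w hw).1 hwD)
  rw [hτ] at h1
  have hτ0 : 0 ≤ τ := hτ ▸ halfSpaceDist_nonneg _ _ _
  have he : 0 ≤ Real.exp τ - 1 := sub_nonneg.2 (Real.one_le_exp hτ0)
  have h2 : ‖z - w‖ ≤ K ^ 2 * (Real.exp τ - 1) * bdryDist D z :=
    calc ‖z - w‖ ≤ K * ‖F z - F w‖ := h.norm_le_map z hz w hw
      _ ≤ K * (K * bdryDist D z * (Real.exp τ - 1)) := by
          refine mul_le_mul_of_nonneg_left (h1.trans ?_) hK0.le
          exact mul_le_mul_of_nonneg_right (h.height_le z hz hzD) he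
      _ = K ^ 2 * (Real.exp τ - 1) * bdryDist D z := by ring
  generalize K ^ 2 * (Real.exp τ - 1) = δ at *
  have h3 : ‖z - w‖ < bdryDist D z := h2.trans_lt (by nlinarith)
  refine (qhEDist_le_of_norm_sub_lt hzD h3).trans (ENNReal.ofReal_le_ofReal ?_)
  refine le_trans ?_ hτ2
  rw [div_le_div_iff₀ (sub_pos.2 h3) (sub_pos.2 hτ1)]
  linarith

/-- Each step of a fine subdivision costs at most `K ^ 3` times its hyperbolic length, and these
lengths add up exactly along a geodesic. The smaller radius puts `F z` and `F w`, hence all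
vertices, in the range of the chart. -/
theorem qhEDist_le_halfSpaceDist (hK : 1 < K) (hd : ∀ u ∈ D, 0 < bdryDist D u)
    (hz : z ∈ Metric.ball a (ρ / K ^ 2)) (hzD : z ∈ D) (hw : w ∈ Metric.ball a (ρ / K ^ 2))
    (hwD : w ∈ D) :
    qhEDist D z w ≤ ENNReal.ofReal (K ^ 3 * halfSpaceDist ν (F z) (F w)) := by
  have hK0 : 0 < K := zero_lt_one.trans hK
  have hρ := h.radius_pos
  have hsub : Metric.ball a (ρ / K ^ 2) ⊆ Metric.ball a ρ := by
    refine Metric.ball_subset_ball (div_le_self hρ.le ?_)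
    nlinarith
  have hF : ∀ x ∈ Metric.ball a (ρ / K ^ 2), ‖F x‖ < ρ / K := by
    intro x hx
    have h1 := h.norm_map_le x (hsub hx) a (Metric.mem_ball_self hρ)
    rw [h.map_center, sub_zero] at h1
    rw [Metric.mem_ball, dist_eq_norm] at hx
    calc ‖F x‖ ≤ K * ‖x - a‖ := h1
      _ < K * (ρ / K ^ 2) := mul_lt_mul_of_pos_left hx hK0
      _ = ρ / K := by field_simp
  set T := halfSpaceDist ν (F z) (F w) with hT
  have hT0 : 0 ≤ T := halfSpaceDist_nonneg _ _ _
  obtain ⟨τ₀, hτ₀, hstep⟩ := exists_step_bound hK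
  obtain ⟨N, hN⟩ := exists_nat_gt (T / τ₀)
  have hN0 : (0 : ℝ) < N := lt_of_le_of_lt (by positivity) hN
  have hτ : T / N < τ₀ := by
    rw [div_lt_iff₀ hτ₀] at hN
    rw [div_lt_iff₀ hN0]
    linarith
  obtain ⟨hs1, hs2⟩ := hstep (T / N) (by positivity) hτ
  obtain ⟨q, hq0, hqN, hq⟩ := exists_chain h.norm_normal ((h.mem_iff z (hsub hz)).1 hzD)
    ((h.mem_iff w (hsub hw)).1 hwD) (Nat.cast_pos.1 hN0)
  have hpre : ∀ i ≤ N, ∃ x ∈ Metric.ball a ρ, F x = q i := fun i hi =>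
    h.surj _ ((hq i hi).2.1.trans_lt (max_lt (hF z hz) (hF w hw)))
  choose! x hx hFx using hpre
  have hinj : ∀ u ∈ Metric.ball a ρ, ∀ v ∈ Metric.ball a ρ, F u = F v → u = v := by
    intro u hu v hv huv
    have := h.norm_le_map u hu v hv
    rw [huv, sub_self, norm_zero, mul_zero] at this
    exact sub_eq_zero.1 (norm_le_zero_iff.1 this)
  have hx0 : x 0 = z := hinj _ (hx 0 (Nat.zero_le _)) _ (hsub hz)
    ((hFx 0 (Nat.zero_le _)).trans hq0)
  have hxN : x N = w := hinj _ (hx N le_rfl) _ (hsub hw) ((hFx N le_rfl).trans hqN)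
  have hxD : ∀ i ≤ N, x i ∈ D := fun i hi =>
    (h.mem_iff _ (hx i hi)).2 (by rw [hFx i hi]; exact (hq i hi).1)
  have hsum : ∀ i ≤ N, qhEDist D (x 0) (x i) ≤ ENNReal.ofReal (i * (K ^ 3 * (T / N))) := by
    intro i
    induction i with
    | zero =>
      intro hi
      rw [qhEDist_self (hxD 0 hi) (hd _ (hxD 0 hi))]
      exact zero_le
    | succ i ih =>
      intro hi
      have hi' : i ≤ N := (Nat.le_succ i).trans hi
      have h1 := h.qhEDist_step_le hK hd (hx i hi') (hx (i + 1) hi) (hxD i hi')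
        (hxD (i + 1) hi) (by rw [hFx i hi', hFx (i + 1) hi]; exact (hq i hi').2.2) hs1 hs2
      refine (qhEDist_triangle (x i)).trans ((add_le_add (ih hi') h1).trans_eq ?_)
      rw [← ENNReal.ofReal_add (by positivity) (by positivity), Nat.cast_succ]
      congr 1
      ring
  have := hsum N le_rfl
  rw [hx0, hxN] at this
  refine this.trans_eq ?_
  congr 1
  field_simp

/-- The hyperbolic distance from `F z`, followed along the path, grows at rate at most `K ^ 2 /
d_D`: one `K` is the Lipschitz constant of `F`, the other compares heights with `d_D`. -/
theorem halfSpaceDist_le_setLIntegral (hK : 1 < K) (hd : ∀ u ∈ D, 0 < bdryDist D u) {L : ℝ}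
    {η : ℝ → EuclideanSpace ℝ (Fin n)} (hη : IsLipPath D z w L η)
    (hB : ∀ t ∈ Icc 0 L, η t ∈ Metric.ball a ρ) :
    ENNReal.ofReal (halfSpaceDist ν (F z) (F w)) ≤
      ENNReal.ofReal (K ^ 2) * ∫⁻ t in Icc 0 L, qhDensity D (η t) := by
  have hK0 : 0 < K := zero_lt_one.trans hK
  have hpos : ∀ t ∈ Icc 0 L, 0 < inner ℝ ν (F (η t)) := fun t ht =>
    (h.mem_iff _ (hB t ht)).1 (hη.mem t)
  have h0 : (0 : ℝ) ∈ Icc 0 L := left_mem_Icc.2 hη.nonneg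
  have := hη.ofReal_sub_le hd (G := fun t => halfSpaceDist ν (F (η 0)) (F (η t)))
    (C := K ^ 2) (by positivity) ?_
  · simp only [hη.source, hη.target] at this
    have hzz : halfSpaceDist ν (F z) (F z) = 0 := by simp [halfSpaceDist]
    rwa [hzz, sub_zero] at this
  · intro s hs t ht
    have h1 : |halfSpaceDist ν (F (η 0)) (F (η s)) - halfSpaceDist ν (F (η 0)) (F (η t))| ≤
        halfSpaceDist ν (F (η s)) (F (η t)) := by
      have t1 := halfSpaceDist_triangle h.norm_normal (hpos 0 h0) (hpos s hs) (hpos t ht)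
      have t2 := halfSpaceDist_triangle h.norm_normal (hpos 0 h0) (hpos t ht) (hpos s hs)
      rw [halfSpaceDist_comm ν (F (η t))] at t2
      rw [abs_le]
      constructor <;> linarith
    refine h1.trans ((halfSpaceDist_le_div h.norm_normal (hpos s hs) (hpos t ht)).trans ?_)
    refine div_sqrt_le hK0 ?_ (abs_nonneg _) (hpos s hs) (hd _ (hη.mem s)) (hpos t ht)
      (hd _ (hη.mem t)) (h.le_height _ (hB s hs) (hη.mem s)) (h.le_height _ (hB t ht) (hη.mem t))
    exact (h.norm_map_le _ (hB s hs) _ (hB t ht)).trans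
      (mul_le_mul_of_nonneg_left (hη.lipschitz.norm_sub_le_abs s t) hK0.le)

/-- Leaving a neighbourhood of a boundary point costs `log (1 / d_D)`, up to constants. -/
theorem log_le_qhEDist_of_notMem_ball (hK : 1 < K) (hd : ∀ u ∈ D, 0 < bdryDist D u) {σ : ℝ}
    (hσ : 0 < σ) (hσρ : σ < ρ) (hz : z ∈ Metric.ball a (σ / 2)) (hzD : z ∈ D)
    (hw : w ∉ Metric.ball a σ) :
    ENNReal.ofReal (Real.log (σ / (4 * K ^ 4)) - Real.log (bdryDist D z)) ≤
      ENNReal.ofReal (K ^ 2) * qhEDist D z w := by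
  have hK0 : 0 < K := zero_lt_one.trans hK
  have hdz := hd z hzD
  rw [qhEDist]
  simp only [ENNReal.mul_iInf_of_ne (ENNReal.ofReal_pos.2 (by positivity : 0 < K ^ 2)).ne'
    ENNReal.ofReal_ne_top]
  refine le_iInf fun L => le_iInf fun η => le_iInf fun hη => ?_
  have hc : Continuous fun t => ‖η t - a‖ :=
    (hη.lipschitz.continuous.sub continuous_const).norm
  rw [Metric.mem_ball, dist_eq_norm] at hz
  rw [Metric.mem_ball, dist_eq_norm, not_lt] at hw
  -- `τ` is the first time the path reaches the sphere of radius `σ`; until then it stays in the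
  -- chart.
  obtain ⟨τ, ⟨⟨hτL, hτσ⟩, hτmin⟩⟩ : ∃ τ, IsLeast (Icc 0 L ∩ {t | σ ≤ ‖η t - a‖}) τ :=
    (isCompact_Icc.inter_right (isClosed_le continuous_const hc)).exists_isLeast
      ⟨L, right_mem_Icc.2 hη.nonneg, by rw [mem_ofPred_eq, hη.target]; exact hw⟩
  have hτeq : ‖η τ - a‖ = σ := by
    obtain ⟨t, ht, htσ⟩ := intermediate_value_Icc hτL.1 hc.continuousOn
      (show σ ∈ Icc ‖η 0 - a‖ ‖η τ - a‖ from ⟨by rw [hη.source]; linarith, hτσ⟩)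
    have : τ ≤ t := hτmin ⟨⟨ht.1, ht.2.trans hτL.2⟩, htσ.ge⟩
    rw [le_antisymm this ht.2]
    exact htσ
  have hin : ∀ t ∈ Icc 0 τ, η t ∈ Metric.ball a ρ := by
    intro t ht
    rw [Metric.mem_ball, dist_eq_norm]
    by_contra! hcon
    have : τ ≤ t := hτmin ⟨⟨ht.1, ht.2.trans hτL.2⟩, by rw [mem_ofPred_eq]; linarith⟩
    rw [← le_antisymm this ht.2, hτeq] at hcon
    linarith
  have hη' : IsLipPath D z (η τ) τ η := ⟨hτL.1, hη.lipschitz, hη.mem, hη.source, rfl⟩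
  refine le_trans ?_ ((h.halfSpaceDist_le_setLIntegral hK hd hη' hin).trans
    (mul_le_mul_right (lintegral_mono_set (Icc_subset_Icc_right hτL.2)) _))
  refine ENNReal.ofReal_le_ofReal ?_
  have hzB : z ∈ Metric.ball a ρ := by rw [Metric.mem_ball, dist_eq_norm]; linarith
  have hτB := hin τ ⟨hτL.1, le_rfl⟩
  have hyz := (h.mem_iff z hzB).1 hzD
  have hyτ := (h.mem_iff _ hτB).1 (hη.mem τ)
  have hm : σ / (2 * K) ≤ ‖F z - F (η τ)‖ := by
    have h1 := h.norm_le_map z hzB _ hτB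
    have h2 := norm_sub_le_norm_sub_add_norm_sub (η τ) z a
    rw [norm_sub_rev (η τ) z, hτeq] at h2
    rw [div_le_iff₀ (by positivity)]
    nlinarith
  have hup : inner ℝ ν (F (η τ)) ≤ K * σ := by
    have h1 := h.norm_map_le _ hτB a (Metric.mem_ball_self h.radius_pos)
    rw [h.map_center, sub_zero, hτeq] at h1
    refine (real_inner_le_norm _ _).trans ?_
    rwa [h.norm_normal, one_mul]
  -- The images are `σ / (2 * K)` apart, at heights at most `K * d_D(z)` and `K * σ`. Since `(σ / (2
  -- * K)) ^ 2 / (K ^ 2 * σ) = σ / (4 * K ^ 4)`, the stated constant follows.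
  have hmain := le_two_mul_arsinh (by positivity : 0 < σ / (2 * K)) hm hyz hyτ
  have l1 := Real.log_le_log hyz (h.height_le z hzB hzD)
  have l2 := Real.log_le_log hyτ hup
  rw [Real.log_mul hK0.ne' hdz.ne'] at l1
  rw [Real.log_mul hK0.ne' hσ.ne'] at l2
  rw [Real.log_div hσ.ne' (by positivity), Real.log_mul two_ne_zero hK0.ne'] at hmain
  rw [Real.log_div hσ.ne' (by positivity), Real.log_mul (by norm_num) (by positivity),
    Real.log_pow, show (4 : ℝ) = 2 ^ 2 by norm_num, Real.log_pow]
  refine le_trans ?_ hmain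
  push_cast
  linarith

end IsBoundaryChart

end Local

/-! ### Comparison of the two distances near one or two points. -/

section Comparison

variable {n : ℕ} {D : Set (EuclideanSpace ℝ (Fin n))} {a b z w : EuclideanSpace ℝ (Fin n)}

/-- A lower bound obtained by cutting a path at an intermediate time. -/
theorem IsLipPath.ofReal_add_le {L τ x y : ℝ} {k : ℝ≥0∞} {η : ℝ → EuclideanSpace ℝ (Fin n)}
    (h : IsLipPath D z w L η) (hτ : τ ∈ Icc 0 L)
    (hx : ENNReal.ofReal x ≤ k * qhEDist D z (η τ))
    (hy : ENNReal.ofReal y ≤ k * qhEDist D w (η τ)) :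
    ENNReal.ofReal (x + y) ≤ k * ∫⁻ t in Icc 0 L, qhDensity D (η t) := by
  refine ENNReal.ofReal_add_le.trans ((add_le_add hx hy).trans ?_)
  rw [← mul_add, qhEDist_comm (z := w)]
  exact mul_le_mul_right (h.qhEDist_add_le hτ) k

theorem le_mul_qhEDist {x : ℝ} {k : ℝ≥0∞} (hk : k ≠ 0) (hk' : k ≠ ⊤)
    (H : ∀ L η, IsLipPath D z w L η →
      ENNReal.ofReal x ≤ k * ∫⁻ t in Icc 0 L, qhDensity D (η t)) :
    ENNReal.ofReal x ≤ k * qhEDist D z w := by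
  rw [qhEDist]
  simp only [ENNReal.mul_iInf_of_ne hk hk']
  exact le_iInf fun L => le_iInf fun η => le_iInf fun hη => H L η hη

theorem bdryDist_le_norm_sub (ha : a ∈ frontier D) : bdryDist D z ≤ ‖z - a‖ := by
  rw [← dist_eq_norm]
  exact Metric.infDist_le_dist_of_mem ha

theorem exists_qhEDist_comparison_pow (hDo : IsOpen D) (ha : IsC1BoundaryPoint D a) {K : ℝ}
    (hK : 1 < K) : ∃ r > 0, ∀ z ∈ D, ‖z - a‖ < r → ∀ w ∈ D, ‖w - a‖ < r →
      qhEDist D z w ≤ ENNReal.ofReal (K ^ 5 * sinhDist D z w) ∧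
      ENNReal.ofReal (sinhDist D z w) ≤ ENNReal.ofReal (K ^ 5) * qhEDist D z w := by
  have hK0 : 0 < K := zero_lt_one.trans hK
  have hd : ∀ u ∈ D, 0 < bdryDist D u := fun u hu => bdryDist_pos hDo ⟨a, ha.1⟩ hu
  obtain ⟨ν, F, ρ, h⟩ := exists_isBoundaryChart hDo ha hK
  have hρ := h.radius_pos
  set σ := ρ / 2 with hσ
  have hσ0 : 0 < σ := half_pos hρ
  set c := σ / (4 * K ^ 4) with hc
  have hc0 : 0 < c := by positivity
  -- The radius `c / 3` gives `√(d_D(z) d_D(w)) + ‖z - w‖ ≤ c`, so `s_D` is at most the cost of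
  -- leaving the chart from both ends.
  refine ⟨min (ρ / K ^ 2) (min (σ / 2) (c / 3)), by positivity, fun z hzD hz w hwD hw => ?_⟩
  simp only [lt_min_iff] at hz hw
  have hball : ∀ {x : EuclideanSpace ℝ (Fin n)} {s : ℝ}, ‖x - a‖ < s → x ∈ Metric.ball a s :=
    fun hx => by rwa [Metric.mem_ball, dist_eq_norm]
  have hzρ : z ∈ Metric.ball a ρ := hball (by linarith [hz.2.1])
  have hwρ : w ∈ Metric.ball a ρ := hball (by linarith [hw.2.1])
  constructor
  · refine (h.qhEDist_le_halfSpaceDist hK hd (hball hz.1) hzD (hball hw.1) hwD).trans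
      (ENNReal.ofReal_le_ofReal ?_)
    have := h.halfSpaceDist_le hK hd hzρ hzD hwρ hwD
    calc K ^ 3 * halfSpaceDist ν (F z) (F w) ≤ K ^ 3 * (K ^ 2 * sinhDist D z w) := by gcongr
      _ = K ^ 5 * sinhDist D z w := by ring
  · refine le_mul_qhEDist (ENNReal.ofReal_pos.2 (by positivity)).ne' ENNReal.ofReal_ne_top
      fun L η hη => ?_
    by_cases hstay : ∀ t ∈ Icc 0 L, η t ∈ Metric.ball a ρ
    · have h1 := h.halfSpaceDist_le_setLIntegral hK hd hη hstay
      have h2 := h.le_halfSpaceDist hK hd hzρ hzD hwρ hwD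
      calc ENNReal.ofReal (sinhDist D z w)
          ≤ ENNReal.ofReal (K ^ 2) * ENNReal.ofReal (halfSpaceDist ν (F z) (F w)) := by
            rw [← ENNReal.ofReal_mul (by positivity)]
            exact ENNReal.ofReal_le_ofReal h2
        _ ≤ ENNReal.ofReal (K ^ 2) *
            (ENNReal.ofReal (K ^ 2) * ∫⁻ t in Icc 0 L, qhDensity D (η t)) := by gcongr
        _ = ENNReal.ofReal (K ^ 4) * ∫⁻ t in Icc 0 L, qhDensity D (η t) := by
            rw [← mul_assoc, ← ENNReal.ofReal_mul (by positivity), ← pow_add]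
        _ ≤ ENNReal.ofReal (K ^ 5) * ∫⁻ t in Icc 0 L, qhDensity D (η t) := by
            gcongr
            · exact hK.le
            · norm_num
    · push Not at hstay
      obtain ⟨τ, hτ, hτB⟩ := hstay
      have hτσ : η τ ∉ Metric.ball a σ := fun hm =>
        hτB (Metric.ball_subset_ball (by linarith) hm)
      have hexit := fun x (hxD : x ∈ D) (hx : x ∈ Metric.ball a (σ / 2)) =>
        h.log_le_qhEDist_of_notMem_ball hK hd hσ0 (by linarith) hx hxD hτσ
      have hdz := hd z hzD
      have hdw := hd w hwD
      have h1 := bdryDist_le_norm_sub (z := z) ha.1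
      have h2 := bdryDist_le_norm_sub (z := w) ha.1
      have h3 := norm_sub_le_norm_sub_add_norm_sub z a w
      rw [norm_sub_rev a w] at h3
      have h4 : √(bdryDist D z * bdryDist D w) ≤ c / 3 := by
        rw [Real.sqrt_le_left (by positivity), sq]
        exact mul_le_mul (by linarith) (by linarith) hdw.le (by positivity)
      have h5 : sinhDist D z w ≤ _ := two_mul_arsinh_le (norm_nonneg (z - w)) hdz hdw
        (show √(bdryDist D z * bdryDist D w) + ‖z - w‖ ≤ c by linarith)
      calc ENNReal.ofReal (sinhDist D z w)
          ≤ ENNReal.ofReal ((Real.log c - Real.log (bdryDist D z)) +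
              (Real.log c - Real.log (bdryDist D w))) :=
            ENNReal.ofReal_le_ofReal (by linarith)
        _ ≤ ENNReal.ofReal (K ^ 2) * ∫⁻ t in Icc 0 L, qhDensity D (η t) :=
            hη.ofReal_add_le hτ (hexit z hzD (hball hz.2.1)) (hexit w hwD (hball hw.2.1))
        _ ≤ ENNReal.ofReal (K ^ 5) * ∫⁻ t in Icc 0 L, qhDensity D (η t) := by
            gcongr
            · exact hK.le
            · norm_num

theorem exists_one_lt_pow_eq {K : ℝ} (hK : 1 < K) {m : ℕ} (hm : m ≠ 0) :
    ∃ k : ℝ, 1 < k ∧ k ^ m = K := by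
  refine ⟨K ^ ((m : ℝ)⁻¹), Real.one_lt_rpow hK (by positivity), ?_⟩
  rw [← Real.rpow_natCast, ← Real.rpow_mul (by linarith), inv_mul_cancel₀ (by positivity),
    Real.rpow_one]

/-- The two distances are comparable near a smooth boundary point. -/
theorem exists_qhEDist_comparison (hDo : IsOpen D) (ha : IsC1BoundaryPoint D a) {K : ℝ}
    (hK : 1 < K) : ∃ r > 0, ∀ z ∈ D, ‖z - a‖ < r → ∀ w ∈ D, ‖w - a‖ < r →
      qhEDist D z w ≤ ENNReal.ofReal (K * sinhDist D z w) ∧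
      ENNReal.ofReal (sinhDist D z w) ≤ ENNReal.ofReal K * qhEDist D z w := by
  obtain ⟨k, hk, rfl⟩ := exists_one_lt_pow_eq hK (m := 5) (by norm_num)
  exact exists_qhEDist_comparison_pow hDo ha hk

theorem le_mul_toReal {x k : ℝ} {e : ℝ≥0∞} (hk : 0 ≤ k) (he : e ≠ ⊤)
    (h : ENNReal.ofReal x ≤ ENNReal.ofReal k * e) : x ≤ k * e.toReal := by
  have h1 := (ENNReal.ofReal_le_iff_le_toReal (ENNReal.mul_ne_top ENNReal.ofReal_ne_top he)).1 h
  rwa [ENNReal.toReal_mul, ENNReal.toReal_ofReal hk] at h1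

theorem abs_div_sub_one_lt {s t ε : ℝ} (hε : 0 < ε) (hs : 0 < s) (h1 : t ≤ (1 + ε / 2) * s)
    (h2 : s ≤ (1 + ε / 2) * t) : |t / s - 1| < ε := by
  have ht : 0 < t := pos_of_mul_pos_right (hs.trans_le h2) (by positivity)
  rw [abs_lt]
  constructor
  · have : 1 - ε < t / s := by
      rw [lt_div_iff₀ hs]
      rcases le_or_gt 1 ε with h | h
      · nlinarith
      · nlinarith [mul_pos hε ht, mul_pos (mul_pos hε hε) ht]
    linarith
  · have : t / s ≤ 1 + ε / 2 := (div_le_iff₀ hs).2 h1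
    linarith

/-- Leaving a neighbourhood of a point of the closure costs `log (1 / d_D)`, up to constants. -/
theorem exists_log_le_qhEDist (hDo : IsOpen D) (hne : (frontier D).Nonempty)
    (hb : b ∈ closure D) (hb' : b ∈ frontier D → IsC1BoundaryPoint D b) {K : ℝ} (hK : 1 < K)
    {σ₀ : ℝ} (hσ₀ : 0 < σ₀) : ∃ (r A : ℝ), 0 < r ∧ r ≤ σ₀ ∧ ∀ z ∈ D, ‖z - b‖ < r →
      ∀ p, p ∉ Metric.ball b σ₀ →
        ENNReal.ofReal (A - Real.log (bdryDist D z)) ≤ ENNReal.ofReal K * qhEDist D z p := by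
  have hd : ∀ u ∈ D, 0 < bdryDist D u := fun u hu => bdryDist_pos hDo hne hu
  by_cases hbD : b ∈ D
  · have hdb := hd b hbD
    -- At an interior point `A` is chosen so that `A - log d_D(z) ≤ 0`, and the bound is trivial.
    refine ⟨min σ₀ (bdryDist D b / 2), Real.log (bdryDist D b / 2), by positivity,
      min_le_left _ _, fun z hzD hz p _ => ?_⟩
    rw [ENNReal.ofReal_of_nonpos]
    · exact zero_le
    · have h1 := bdryDist_le_add (D := D) (z := b) (w := z)
      rw [norm_sub_rev] at h1
      have := Real.log_le_log (by positivity : 0 < bdryDist D b / 2)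
        (show bdryDist D b / 2 ≤ bdryDist D z by linarith [hz.trans_le (min_le_right _ _)])
      linarith
  · have hbf : b ∈ frontier D := by rw [hDo.frontier_eq]; exact ⟨hb, hbD⟩
    obtain ⟨k, hk, rfl⟩ := exists_one_lt_pow_eq hK (m := 2) (by norm_num)
    obtain ⟨ν, F, ρ, h⟩ := exists_isBoundaryChart hDo (hb' hbf) hk
    have hρ := h.radius_pos
    set σ := min σ₀ (ρ / 2) with hσ
    have hσ0 : 0 < σ := by positivity
    refine ⟨σ / 2, Real.log (σ / (4 * k ^ 4)), by positivity, by
      linarith [min_le_left σ₀ (ρ / 2)], fun z hzD hz p hp => ?_⟩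
    refine h.log_le_qhEDist_of_notMem_ball hk hd hσ0 ?_ ?_ hzD fun hm =>
      hp (Metric.ball_subset_ball (min_le_left _ _) hm)
    · linarith [min_le_right σ₀ (ρ / 2)]
    · rwa [Metric.mem_ball, dist_eq_norm]

/-- Reaching a point of the closure costs at most `log (1 / d_D)`, up to constants. -/
theorem exists_qhEDist_le_log (hDo : IsOpen D) (hne : (frontier D).Nonempty)
    (hb : b ∈ closure D) (hb' : b ∈ frontier D → IsC1BoundaryPoint D b) {K : ℝ} (hK : 1 < K) :
    ∃ (w₀ : EuclideanSpace ℝ (Fin n)) (r A : ℝ), w₀ ∈ D ∧ 0 < r ∧ ∀ z ∈ D, ‖z - b‖ < r →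
      (qhEDist D z w₀).toReal ≤ K * (A - Real.log (bdryDist D z)) := by
  have hd : ∀ u ∈ D, 0 < bdryDist D u := fun u hu => bdryDist_pos hDo hne hu
  by_cases hbD : b ∈ D
  · have hdb := hd b hbD
    -- The `1` added to `A` pays for the segment from `b`, since `d_D(z) ≤ 2 d_D(b)` nearby.
    refine ⟨b, bdryDist D b / 2, Real.log (2 * bdryDist D b) + 1, hbD, by positivity,
      fun z hzD hz => ?_⟩
    rw [qhEDist_comm]
    rw [norm_sub_rev] at hz
    have h1 := bdryDist_le_add (D := D) (z := z) (w := b)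
    rw [norm_sub_rev] at h1
    have h2 := Real.log_le_log (hd z hzD) (show bdryDist D z ≤ 2 * bdryDist D b by linarith)
    have h3 : (qhEDist D b z).toReal ≤ 1 := by
      refine ENNReal.toReal_le_of_le_ofReal zero_le_one
        ((qhEDist_le_of_norm_sub_lt hbD (by linarith)).trans (ENNReal.ofReal_le_ofReal ?_))
      rw [div_le_one (by linarith)]
      linarith
    nlinarith
  · have hbf : b ∈ frontier D := by rw [hDo.frontier_eq]; exact ⟨hb, hbD⟩
    obtain ⟨r, hr, hcomp⟩ := exists_qhEDist_comparison hDo (hb' hbf) hK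
    obtain ⟨w₀, hw₀D, hw₀⟩ := Metric.mem_closure_iff.1 hb r hr
    rw [dist_comm, dist_eq_norm] at hw₀
    refine ⟨w₀, r, 2 * Real.log (3 * r) - Real.log (bdryDist D w₀), hw₀D, hr,
      fun z hzD hz => ?_⟩
    have hdz := hd z hzD
    have hdw := hd w₀ hw₀D
    have h1 := bdryDist_le_norm_sub (z := z) hbf
    have h2 := bdryDist_le_norm_sub (z := w₀) hbf
    have h3 := norm_sub_le_norm_sub_add_norm_sub z b w₀
    rw [norm_sub_rev b w₀] at h3
    have h4 : √(bdryDist D z * bdryDist D w₀) ≤ r := by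
      rw [Real.sqrt_le_left (by positivity), sq]
      exact mul_le_mul (by linarith) (by linarith) hdw.le (by positivity)
    have h5 : sinhDist D z w₀ ≤ _ := two_mul_arsinh_le (norm_nonneg (z - w₀)) hdz hdw
      (show √(bdryDist D z * bdryDist D w₀) + ‖z - w₀‖ ≤ 3 * r by linarith)
    have hK0 : 0 ≤ K := by linarith
    refine (ENNReal.toReal_le_of_le_ofReal (mul_nonneg hK0 sinhDist_nonneg)
      (hcomp z hzD hz w₀ hw₀D hw₀).1).trans (mul_le_mul_of_nonneg_left ?_ hK0)
    linarith

theorem qhEDist_toReal_triangle (hDo : IsOpen D) (hDc : IsConnected D)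
    (hne : (frontier D).Nonempty) {u : EuclideanSpace ℝ (Fin n)} (hz : z ∈ D) (hu : u ∈ D)
    (hw : w ∈ D) :
    (qhEDist D z w).toReal ≤ (qhEDist D z u).toReal + (qhEDist D u w).toReal := by
  have h1 := qhEDist_ne_top hDo hDc hne hz hu
  have h2 := qhEDist_ne_top hDo hDc hne hu hw
  rw [← ENNReal.toReal_add h1 h2]
  exact ENNReal.toReal_mono (ENNReal.add_ne_top.2 ⟨h1, h2⟩) (qhEDist_triangle u)

/-- Both distances between points near distinct points of the closure are
`log (1 / d_D(z)) + log (1 / d_D(w))`, up to constants. -/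
theorem exists_comparison_of_ne (hDo : IsOpen D) (hDc : IsConnected D)
    (ha : a ∈ closure D) (ha' : a ∈ frontier D → IsC1BoundaryPoint D a)
    (hb : b ∈ closure D) (hb' : b ∈ frontier D → IsC1BoundaryPoint D b)
    (hne : (frontier D).Nonempty) (hab : a ≠ b) {K : ℝ} (hK : 1 < K) :
    ∃ (r C : ℝ), 0 < r ∧ 0 ≤ C ∧ ∀ z ∈ D, ‖z - a‖ < r → ∀ w ∈ D, ‖w - b‖ < r →
      (qhEDist D z w).toReal ≤
        K * (-Real.log (bdryDist D z) - Real.log (bdryDist D w)) + C ∧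
      -Real.log (bdryDist D z) - Real.log (bdryDist D w) - C ≤ K * (qhEDist D z w).toReal ∧
      |sinhDist D z w - (-Real.log (bdryDist D z) - Real.log (bdryDist D w))| ≤ C := by
  have hd : ∀ u ∈ D, 0 < bdryDist D u := fun u hu => bdryDist_pos hDo hne hu
  have hK0 : 0 < K := zero_lt_one.trans hK
  set δ := ‖a - b‖ with hδ
  have hδ0 : 0 < δ := norm_pos_iff.2 (sub_ne_zero.2 hab)
  have hσ : 0 < δ / 4 := by positivity
  obtain ⟨r₁, A₁, hr₁, hrσ₁, hlow₁⟩ := exists_log_le_qhEDist hDo hne ha ha' hK hσ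
  obtain ⟨r₂, A₂, hr₂, hrσ₂, hlow₂⟩ := exists_log_le_qhEDist hDo hne hb hb' hK hσ
  obtain ⟨z₀, r₃, A₃, hz₀, hr₃, hup₁⟩ := exists_qhEDist_le_log hDo hne ha ha' hK
  obtain ⟨w₀, r₄, A₄, hw₀, hr₄, hup₂⟩ := exists_qhEDist_le_log hDo hne hb hb' hK
  set H := (qhEDist D z₀ w₀).toReal with hH
  set M := (bdryDist D a + bdryDist D b + 3 * δ) with hM
  have ha0 : 0 ≤ bdryDist D a := Metric.infDist_nonneg
  have hb0 : 0 ≤ bdryDist D b := Metric.infDist_nonneg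
  set C := |K * (A₃ + A₄) + H| + |A₁ + A₂| + |2 * Real.log M| + |2 * Real.log (δ / 2)| with hC
  refine ⟨min (min r₁ r₂) (min r₃ r₄), C, by positivity, by positivity,
    fun z hzD hz w hwD hw => ?_⟩
  simp only [lt_min_iff] at hz hw
  have hdz := hd z hzD
  have hdw := hd w hwD
  have hC1 := le_abs_self (K * (A₃ + A₄) + H)
  have hC2 := neg_abs_le (A₁ + A₂)
  have hC3 := le_abs_self (2 * Real.log M)
  have hC4 := neg_abs_le (2 * Real.log (δ / 2))
  have p1 := abs_nonneg (K * (A₃ + A₄) + H)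
  have p2 := abs_nonneg (A₁ + A₂)
  have p3 := abs_nonneg (2 * Real.log M)
  have p4 := abs_nonneg (2 * Real.log (δ / 2))
  refine ⟨?_, ?_, ?_⟩
  · have t1 := qhEDist_toReal_triangle hDo hDc hne hzD hz₀ hwD
    have t2 := qhEDist_toReal_triangle hDo hDc hne hz₀ hw₀ hwD
    have u1 := hup₁ z hzD hz.2.1
    have u2 := hup₂ w hwD hw.2.2
    rw [qhEDist_comm (z := w)] at u2
    linarith
  · have : A₁ - Real.log (bdryDist D z) + (A₂ - Real.log (bdryDist D w)) ≤
        K * (qhEDist D z w).toReal := by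
      refine le_mul_toReal hK0.le (qhEDist_ne_top hDo hDc hne hzD hwD)
        (le_mul_qhEDist (ENNReal.ofReal_pos.2 hK0).ne' ENNReal.ofReal_ne_top fun L η hη => ?_)
      -- The two balls are disjoint and `[0, L]` is connected, so at some time the path lies in
      -- neither.
      obtain ⟨τ, hτ, hτa, hτb⟩ : ∃ τ ∈ Icc 0 L, η τ ∉ Metric.ball a (δ / 4) ∧
          η τ ∉ Metric.ball b (δ / 4) := by
        by_contra! hcon
        have hc : Continuous η := hη.lipschitz.continuous
        obtain ⟨t, -, ht1, ht2⟩ := isPreconnected_Icc (a := (0 : ℝ)) (b := L)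
          (η ⁻¹' Metric.ball a (δ / 4)) (η ⁻¹' Metric.ball b (δ / 4))
          (Metric.isOpen_ball.preimage hc) (Metric.isOpen_ball.preimage hc)
          (fun t ht => or_iff_not_imp_left.2 (hcon t ht))
          ⟨0, left_mem_Icc.2 hη.nonneg, by
            rw [mem_preimage, hη.source, Metric.mem_ball, dist_eq_norm]; linarith [hz.1.1]⟩
          ⟨L, right_mem_Icc.2 hη.nonneg, by
            rw [mem_preimage, hη.target, Metric.mem_ball, dist_eq_norm]; linarith [hw.1.2]⟩
        rw [mem_preimage, Metric.mem_ball, dist_eq_norm] at ht1 ht2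
        have := norm_sub_le_norm_sub_add_norm_sub a (η t) b
        rw [norm_sub_rev a (η t)] at this
        linarith
      exact hη.ofReal_add_le hτ (hlow₁ z hzD hz.1.1 _ hτa) (hlow₂ w hwD hw.1.2 _ hτb)
    linarith
  · have hza : ‖z - a‖ < δ / 4 := hz.1.1.trans_le hrσ₁
    have hwb : ‖w - b‖ < δ / 4 := hw.1.2.trans_le hrσ₂
    have n1 : δ / 2 ≤ ‖z - w‖ := by
      have e1 := norm_sub_le_norm_sub_add_norm_sub a z b
      have e2 := norm_sub_le_norm_sub_add_norm_sub z w b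
      rw [norm_sub_rev a z] at e1
      linarith
    have n2 : ‖z - w‖ ≤ 2 * δ := by
      have e1 := norm_sub_le_norm_sub_add_norm_sub z a w
      have e2 := norm_sub_le_norm_sub_add_norm_sub a b w
      rw [norm_sub_rev b w] at e2
      linarith
    have n3 : √(bdryDist D z * bdryDist D w) ≤ bdryDist D a + bdryDist D b + δ := by
      have e1 := bdryDist_le_add (D := D) (z := z) (w := a)
      have e2 := bdryDist_le_add (D := D) (z := w) (w := b)
      rw [Real.sqrt_le_left (by positivity), sq]
      exact mul_le_mul (by linarith) (by linarith) hdw.le (by positivity)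
    have s1 : sinhDist D z w ≤ _ := two_mul_arsinh_le (norm_nonneg (z - w)) hdz hdw
      (show √(bdryDist D z * bdryDist D w) + ‖z - w‖ ≤ M by linarith)
    have s2 : _ ≤ sinhDist D z w := le_two_mul_arsinh (half_pos hδ0) n1 hdz hdw
    rw [abs_le]
    constructor <;> linarith

end Comparison

/-! ### Passage to the limit and compactness. -/

section Limits

variable {n : ℕ} {D : Set (EuclideanSpace ℝ (Fin n))} {a b : EuclideanSpace ℝ (Fin n)}

theorem eventually_ratio_of_boundary_point (hDo : IsOpen D) (hDc : IsConnected D)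
    (ha : IsC1BoundaryPoint D a) {ε : ℝ} (hε : 0 < ε) :
    ∀ᶠ p : EuclideanSpace ℝ (Fin n) × EuclideanSpace ℝ (Fin n) in 𝓝 (a, a),
      p.1 ∈ D → p.2 ∈ D → p.1 ≠ p.2 →
        |quasihyperbolicDist D p.1 p.2 / sinhDist D p.1 p.2 - 1| < ε := by
  have hne : (frontier D).Nonempty := ⟨a, ha.1⟩
  obtain ⟨r, hr, h⟩ := exists_qhEDist_comparison hDo ha (K := 1 + ε / 2) (by linarith)
  filter_upwards [prod_mem_nhds (Metric.ball_mem_nhds a hr) (Metric.ball_mem_nhds a hr)]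
  rintro ⟨z, w⟩ ⟨hz, hw⟩ hzD hwD hzw
  rw [Metric.mem_ball, dist_eq_norm] at hz hw
  obtain ⟨h1, h2⟩ := h z hzD hz w hwD hw
  rw [quasihyperbolicDist_eq]
  exact abs_div_sub_one_lt hε
    (sinhDist_pos (bdryDist_pos hDo hne hzD) (bdryDist_pos hDo hne hwD) hzw)
    (ENNReal.toReal_le_of_le_ofReal (mul_nonneg (by positivity) sinhDist_nonneg) h1)
    (le_mul_toReal (by positivity) (qhEDist_ne_top hDo hDc hne hzD hwD) h2)

theorem eventually_ratio_of_ne (hDo : IsOpen D) (hDc : IsConnected D)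
    (ha : IsC1BoundaryPoint D a) (hb : b ∈ closure D)
    (hb' : b ∈ frontier D → IsC1BoundaryPoint D b) (hab : a ≠ b) {ε : ℝ} (hε : 0 < ε) :
    ∀ᶠ p : EuclideanSpace ℝ (Fin n) × EuclideanSpace ℝ (Fin n) in 𝓝 (a, b),
      p.1 ∈ D → p.2 ∈ D → p.1 ≠ p.2 →
        |quasihyperbolicDist D p.1 p.2 / sinhDist D p.1 p.2 - 1| < ε := by
  have hne : (frontier D).Nonempty := ⟨a, ha.1⟩
  set K := 1 + ε / 4 with hK
  obtain ⟨r, C, hr, hC, h⟩ := exists_comparison_of_ne hDo hDc (frontier_subset_closure ha.1)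
    (fun _ => ha) hb hb' hne hab (K := K) (by linarith)
  -- Above this threshold the additive errors are at most `ε / 4` times the distances; the other `ε
  -- / 4` is used up by `K`.
  set M := 2 * C + 8 * K * C / ε with hM
  have hB : 0 < bdryDist D b + r := add_pos_of_nonneg_of_pos Metric.infDist_nonneg hr
  -- Since `d_D(w)` stays below `d_D(b) + r`, this forces `d_D(z) d_D(w) ≤ exp (-(M + C))`.
  set r' := min r (Real.exp (-(M + C)) / (bdryDist D b + r)) with hr'
  have hr'0 : 0 < r' := by positivity
  filter_upwards [prod_mem_nhds (Metric.ball_mem_nhds a hr'0) (Metric.ball_mem_nhds b hr)]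
  rintro ⟨z, w⟩ ⟨hz, hw⟩ hzD hwD hzw
  rw [Metric.mem_ball, dist_eq_norm] at hz hw
  simp only at hz hw hzD hwD hzw ⊢
  obtain ⟨h1, h2, h3⟩ := h z hzD (hz.trans_le (min_le_left _ _)) w hwD hw
  have hdz := bdryDist_pos hDo hne hzD
  have hdw := bdryDist_pos hDo hne hwD
  have hS : M + C ≤ -Real.log (bdryDist D z) - Real.log (bdryDist D w) := by
    have e1 : bdryDist D z ≤ Real.exp (-(M + C)) / (bdryDist D b + r) :=
      (bdryDist_le_norm_sub ha.1).trans (hz.le.trans (min_le_right _ _))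
    have e2 : bdryDist D w ≤ bdryDist D b + r := (bdryDist_le_add (w := b)).trans (by linarith)
    have e3 : bdryDist D z * bdryDist D w ≤ Real.exp (-(M + C)) :=
      calc bdryDist D z * bdryDist D w
          ≤ Real.exp (-(M + C)) / (bdryDist D b + r) * (bdryDist D b + r) := by gcongr
        _ = Real.exp (-(M + C)) := div_mul_cancel₀ _ hB.ne'
    have e4 := Real.log_le_log (mul_pos hdz hdw) e3
    rw [Real.log_exp, Real.log_mul hdz.ne' hdw.ne'] at e4
    linarith
  generalize -Real.log (bdryDist D z) - Real.log (bdryDist D w) = S at *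
  have hspos := sinhDist_pos hdz hdw hzw
  rw [quasihyperbolicDist_eq]
  generalize (qhEDist D z w).toReal = t at *
  generalize sinhDist D z w = s at *
  obtain ⟨h3, h4⟩ := abs_le.1 h3
  have hK1 : 1 ≤ K := by linarith
  have hK0 : 0 < K := by linarith
  have hεM : ε / 4 * M = ε * C / 2 + 2 * K * C := by rw [hM]; field_simp; ring
  have hsM : M ≤ s := by linarith
  refine abs_div_sub_one_lt hε hspos ?_ ?_
  · have i1 : K * S ≤ K * (s + C) := mul_le_mul_of_nonneg_left (by linarith) hK0.le
    have i2 : ε / 4 * M ≤ ε / 4 * s := mul_le_mul_of_nonneg_left hsM (by positivity)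
    have i3 : C ≤ K * C := le_mul_of_one_le_left hC hK1
    have i4 : 0 ≤ ε * C := by positivity
    have i5 : (1 + ε / 2) * s = K * s + ε / 4 * s := by rw [hK]; ring
    linarith
  · have i1 : 8 * C / ε ≤ t := by
      have : K * (8 * C / ε) ≤ K * t := by
        have : 8 * K * C / ε = K * (8 * C / ε) := by ring
        linarith
      exact le_of_mul_le_mul_left this hK0
    have i2 : 2 * C ≤ ε / 4 * t := by
      rw [div_le_iff₀ hε] at i1
      linarith
    have i3 : (1 + ε / 2) * t = K * t + ε / 4 * t := by rw [hK]; ring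
    linarith

/-- Two distinct points exclude dimension zero, where the whole space is bounded with empty
frontier. -/
theorem frontier_nonempty_of_isBounded (hDc : IsConnected D) (hb : Bornology.IsBounded D)
    (hab : a ≠ b) : (frontier D).Nonempty := by
  rw [nonempty_frontier_iff]
  refine ⟨hDc.nonempty, fun h => ?_⟩
  have : Nontrivial (EuclideanSpace ℝ (Fin n)) := ⟨a, b, hab⟩
  exact NormedSpace.noncompactSpace ℝ (EuclideanSpace ℝ (Fin n)) |>.noncompact_univ
    (Metric.isCompact_of_isClosed_isBounded isClosed_univ (h ▸ hb))

theorem IsCompact.exists_pos_forall_dist_lt {X : Type*} [PseudoMetricSpace X] {T : Set X}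
    (hT : IsCompact T) {P : X → Prop} (h : ∀ x ∈ T, ∀ᶠ y in 𝓝 x, P y) :
    ∃ δ > 0, ∀ x ∈ T, ∀ y, dist y x < δ → P y := by
  obtain ⟨δ, hδ, hsub⟩ := (Metric.hasBasis_nhdsSet_thickening hT).mem_iff.1
    (mem_nhdsSet_iff_forall.2 h)
  exact ⟨δ, hδ, fun x hx y hy => hsub (Metric.mem_thickening_iff.2 ⟨x, hx, hy⟩)⟩

theorem exists_uniform_ratio (hDo : IsOpen D) (hDc : IsConnected D)
    (hb : Bornology.IsBounded D) (hs : ∀ a ∈ frontier D, IsC1BoundaryPoint D a) {ε : ℝ}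
    (hε : 0 < ε) : ∃ δ : ℝ, 0 < δ ∧ ∀ z ∈ D, bdryDist D z < δ → ∀ w ∈ D, w ≠ z →
      |quasihyperbolicDist D z w / sinhDist D z w - 1| < ε := by
  have hc : IsCompact (closure D) := hb.isCompact_closure
  have hT : IsCompact (frontier D ×ˢ closure D) :=
    (hc.of_isClosed_subset isClosed_frontier frontier_subset_closure).prod hc
  obtain ⟨δ, hδ, h⟩ := hT.exists_pos_forall_dist_lt
    (P := fun p => p.1 ∈ D → p.2 ∈ D → p.1 ≠ p.2 →
        |quasihyperbolicDist D p.1 p.2 / sinhDist D p.1 p.2 - 1| < ε) (by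
      rintro ⟨a, b⟩ hab
      by_cases h : a = b
      · subst h
        exact eventually_ratio_of_boundary_point hDo hDc (hs a hab.1) hε
      · exact eventually_ratio_of_ne hDo hDc (hs a hab.1) hab.2 (hs b) h hε)
  refine ⟨δ, hδ, fun z hz hzδ w hw hwz => ?_⟩
  have hne := frontier_nonempty_of_isBounded hDc hb hwz
  -- The pair `(z, w)` is within `δ` of `(a, w)`, which lies in the compact set.
  obtain ⟨a, ha, hza⟩ := (Metric.infDist_lt_iff hne).1 hzδ
  refine h (a, w) ⟨ha, subset_closure hw⟩ (z, w) ?_ hz hw hwz.symm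
  rw [Prod.dist_eq, dist_self]
  exact max_lt hza hδ

end Limits

theorem mainTheorem6 {n : ℕ} (D : Set (EuclideanSpace ℝ (Fin n)))
    (hDo : IsOpen D) (hDc : IsConnected D) :
    (∀ a : EuclideanSpace ℝ (Fin n), IsC1BoundaryPoint D a →
      Tendsto
        (fun p : EuclideanSpace ℝ (Fin n) × EuclideanSpace ℝ (Fin n) =>
          quasihyperbolicDist D p.1 p.2 / sinhDist D p.1 p.2)
        (𝓝[{p | p.1 ∈ D ∧ p.2 ∈ D ∧ p.1 ≠ p.2}] (a, a)) (𝓝 1)) ∧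
    (Bornology.IsBounded D → (∀ a ∈ frontier D, IsC1BoundaryPoint D a) →
      ∀ ε : ℝ, 0 < ε → ∃ δ : ℝ, 0 < δ ∧ ∀ z ∈ D, bdryDist D z < δ → ∀ w ∈ D, w ≠ z →
        |quasihyperbolicDist D z w / sinhDist D z w - 1| < ε) := by
  refine ⟨fun a ha => Metric.tendsto_nhds.2 fun ε hε => ?_,
    fun hb hs ε hε => exists_uniform_ratio hDo hDc hb hs hε⟩
  filter_upwards [nhdsWithin_le_nhds (eventually_ratio_of_boundary_point hDo hDc ha hε),
    self_mem_nhdsWithin] with p hp hpD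
  rw [Real.dist_eq]
  exact hp hpD.1 hpD.2.1 hpD.2.2
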